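/- Let $n\ge 2$ and equip $\mathbb R^{2n}$, with coordinates $x_1,\dots,x_n,y_1,\dots,y_n$, with the Euclidean norm and the standard symplectic form $\omega_{\mathrm{st}}=\sum_{i=1}^n dx_i\wedge dy_i$. Let $B_\rho\subset\mathbb R^{2n}$ be the open ball of radius $\rho$ about the origin. For $\delta\in(0,1)$ let $A_\delta=\overline{B_1}\setminus B_{1-\delta}$, and for an open subset $V\subset\mathbb R^{2n}$ let $$c_\delta(V)=\sup\{\pi r^2 \mid r>0,\ rA_\delta \text{ embeds symplectically into } (V,\omega_{\mathrm{st}})\}\in[0,\infty],$$ where a symplectic embedding of $rA_\delta$ into $V$ means a smooth embedding $\varphi:O\to V$ of some open neighbourhood $O\subset\mathbb R^{2n}$ of $rA_\delta$ with $\varphi^*\omega_{\mathrm{st}}=\omega_{\mathrm{st}}$. For $\varepsilon\in(0,1)$ let $U_\varepsilon=B_1\setminus\overline{B_{1-\varepsilon}}$. Then for every $\delta\in(0,1)$ the function $(0,1)\to[0,\infty]$, $\varepsilon\mapsto c_\delta(U_\varepsilon)$, is discontinuous at $\varepsilon=\delta$. More precisely, for $\varepsilon\in(0,1)$, $$c_\delta(U_\varepsilon)\le\bigl(1-(1-\delta)^{2n}\bigr)^{1/n}\,\pi\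 \text{ if }\varepsilon\le\delta,\qquad c_\delta(U_\varepsilon)=\pi\ \text{ if }\varepsilon>\delta.$$ -/

import Mathlib

open Set Metric Topology
open scoped ContDiff ENNReal Pointwise

/-- The space `ℝ²ⁿ` with its Euclidean norm. The coordinate `x_i` of a vector `v` is `v (Sum.inl i)`
and the coordinate `y_i` is `v (Sum.inr i)`. -/
abbrev PhaseSpace (n : ℕ) : Type := EuclideanSpace ℝ (Fin n ⊕ Fin n)

/-- The standard symplectic form `ω = ∑ i, dx_i ∧ dy_i` on `ℝ²ⁿ`, evaluated on two tangent
vectors. -/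
def stdSymplecticForm {n : ℕ} (v w : PhaseSpace n) : ℝ :=
  ∑ i : Fin n, (v (Sum.inl i) * w (Sum.inr i) - v (Sum.inr i) * w (Sum.inl i))

/-- The restriction of `φ` to the open set `O ⊆ ℝ²ⁿ` is a symplectic embedding of `O` into the
subset `V` of `ℝ²ⁿ`: it is smooth, a homeomorphism onto its image, takes values in `V`, and pulls
the standard symplectic form back to itself (so that it is in particular an immersion). -/
structure IsSymplecticEmbeddingOn {n : ℕ} (φ : PhaseSpace n → PhaseSpace n)
    (O V : Set (PhaseSpace n)) : Prop where
  isOpen_source : IsOpen O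
  contDiffOn : ContDiffOn ℝ ∞ φ O
  isEmbedding : IsEmbedding (fun p : O => φ p)
  mapsTo : MapsTo φ O V
  pullback_eq : ∀ p ∈ O, ∀ v w : PhaseSpace n,
    stdSymplecticForm (fderiv ℝ φ p v) (fderiv ℝ φ p w) = stdSymplecticForm v w

/-- A symplectic embedding of an arbitrary subset `A` of `ℝ²ⁿ` into an open subset `V` of `ℝ²ⁿ`
is a symplectic embedding of some open neighbourhood of `A` into `V`. -/
def SymplecticallyEmbeds {n : ℕ} (A V : Set (PhaseSpace n)) : Prop :=
  ∃ (O : Set (PhaseSpace n)) (φ : PhaseSpace n → PhaseSpace n),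
    A ⊆ O ∧ IsSymplecticEmbeddingOn φ O V

/-- The closed spherical shell `A_δ`: the closed unit ball minus the open ball of radius
`1 - δ`. -/
def closedShell (n : ℕ) (δ : ℝ) : Set (PhaseSpace n) :=
  closedBall 0 1 \ ball 0 (1 - δ)

/-- The open spherical shell `U_ε`: the open unit ball minus the closed ball of radius
`1 - ε`. -/
def openShell (n : ℕ) (ε : ℝ) : Set (PhaseSpace n) :=
  ball 0 1 \ closedBall 0 (1 - ε)

/-- The `δ`-shell capacity, with values in `[0, ∞]`, of an open subset `V` of `ℝ²ⁿ` with the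
standard symplectic form: the supremum of `π r²` over all radii `r > 0` such that the scaled closed
shell `r A_δ` embeds symplectically into `V`. -/
noncomputable def shellCapacity {n : ℕ} (δ : ℝ) (V : Set (PhaseSpace n)) : ℝ≥0∞ :=
  sSup {c : ℝ≥0∞ | ∃ r : ℝ, 0 < r ∧ SymplecticallyEmbeds (r • closedShell n δ) V ∧
    c = ENNReal.ofReal (Real.pi * r ^ 2)}

/-! Let `φ` embed `r A_δ` symplectically into `U_ε`, and let λ be a primitive of ω. Since `n ≥ 2`,
the shell has no first cohomology, so `φ^*λ - λ`, being closed, is exact. By Stokes the image of the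
concentric sphere of radius `t` therefore encloses, counted with degree, exactly the volume of
`B_t`. For the outer sphere this forces `r < 1`. Suppose moreover `ε ≤ δ`. The image misses the
closed ball of radius `1 - ε`, so the outer sphere encloses all of this connected ball or none of
it. If all, then so does the inner sphere, since the image of the shell between them misses the
ball; comparing volumes, `1 - ε ≤ r (1 - δ) < 1 - δ`, which is absurd. Hence none, and the two
disjoint regions inside `B_1` give `r ^ (2n) + (1 - ε) ^ (2n) ≤ 1`. For `ε > δ`, inclusions with `r`
close to `1` show that the bound `r < 1` is sharp, whence the jump at `ε = δ`.

"Enclosing" is made precise without a separation theorem. The embedding is cut off to a smooth map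
`Φ` of the whole space, spheres are thickened to collars on which a radial cut-off drops from `1` to
`0`, and `smoothedDegree` is the mapping degree averaged against a mollifier. Three facts carry the
proof: `integral_radial_mul_det_jacobian` (enclosed volume, resting on Piola's identity and on
`integral_radial_mul_closed_hopf`), `smoothedDegree_mem_Icc_and_eq` (the degree lies in `[0, 1]`,
and in `{0, 1}` off the image of the collar), and `SymplecticallyEmbeds.radius_bounds`, which
assembles the argument above. -/

open MeasureTheory Matrix

/-! ### Piola's identity and change of variables by integration by parts. -/

section Piola

variable {ι : Type*} [Fintype ι] [DecidableEq ι]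

/-- The determinant as a continuous multilinear function of the rows. -/
noncomputable def detRowContinuous (ι : Type*) [Fintype ι] [DecidableEq ι] :
    ContinuousMultilinearMap ℝ (fun _ : ι => ι → ℝ) ℝ :=
  { (Matrix.detRowAlternating : (ι → ℝ) [⋀^ι]→ₗ[ℝ] ℝ).toMultilinearMap with
    cont := by
      change Continuous fun M : Matrix ι ι ℝ => M.det
      exact Continuous.matrix_det continuous_id }

theorem hasFDerivAt_det_rows {G : Type*} [NormedAddCommGroup G] [NormedSpace ℝ G]
    {m : ι → G → ι → ℝ} {m' : ι → G →L[ℝ] ι → ℝ} {x : G}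
    (h : ∀ k, HasFDerivAt (m k) (m' k) x) :
    HasFDerivAt (fun y => det (of fun k => m k y))
      (∑ k, ((detRowContinuous ι).toContinuousLinearMap (fun j => m j x) k) ∘L (m' k)) x :=
  HasFDerivAt.multilinear_comp (detRowContinuous ι) h

theorem fderiv_det_rows {G : Type*} [NormedAddCommGroup G] [NormedSpace ℝ G]
    {m : ι → G → ι → ℝ} {x : G} (h : ∀ k, DifferentiableAt ℝ (m k) x) (v : G) :
    fderiv ℝ (fun y => det (of fun k => m k y)) x v =
      ∑ k, det ((of fun k => m k x).updateRow k (fderiv ℝ (m k) x v)) := by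
  rw [(hasFDerivAt_det_rows fun k => (h k).hasFDerivAt).fderiv]
  simp only [_root_.sum_apply]
  rfl

/-- The Jacobian matrix of a self-map of Euclidean space. -/
noncomputable def jacobian (Φ : EuclideanSpace ℝ ι → EuclideanSpace ℝ ι)
    (x : EuclideanSpace ℝ ι) : Matrix ι ι ℝ :=
  of fun i j => fderiv ℝ Φ x (EuclideanSpace.single j 1) i

/-- The divergence of a vector field on Euclidean space. -/
noncomputable def divergence (F : EuclideanSpace ℝ ι → EuclideanSpace ℝ ι)
    (x : EuclideanSpace ℝ ι) : ℝ :=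
  ∑ i, fderiv ℝ F x (EuclideanSpace.single i 1) i

theorem EuclideanSpace.sum_single (v : EuclideanSpace ℝ ι) :
    ∑ j, v j • EuclideanSpace.single j (1 : ℝ) = v := by
  ext k
  simp [Finset.sum_apply, Pi.single_apply]

theorem EuclideanSpace.map_eq_sum {G : Type*} [NormedAddCommGroup G] [NormedSpace ℝ G]
    (L : EuclideanSpace ℝ ι →L[ℝ] G) (v : EuclideanSpace ℝ ι) :
    L v = ∑ j, v j • L (EuclideanSpace.single j 1) := by
  conv_lhs => rw [← EuclideanSpace.sum_single v]
  simp

theorem fderiv_euclidean_apply {κ G : Type*} [Fintype κ] [NormedAddCommGroup G] [NormedSpace ℝ G]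
    {F : G → EuclideanSpace ℝ κ} {x : G} (h : DifferentiableAt ℝ F x) (v : G) (i : κ) :
    fderiv ℝ (fun y => F y i) x v = fderiv ℝ F x v i := by
  have := ((EuclideanSpace.proj (𝕜 := ℝ) (ι := κ) i : EuclideanSpace ℝ κ →L[ℝ] ℝ).hasFDerivAt.comp x
    h.hasFDerivAt).fderiv
  exact DFunLike.congr_fun this v

theorem contDiff_jacobian_apply {Φ : EuclideanSpace ℝ ι → EuclideanSpace ℝ ι}
    (hΦ : ContDiff ℝ ∞ Φ) (i j : ι) : ContDiff ℝ ∞ fun x => jacobian Φ x i j := by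
  have h : ContDiff ℝ ∞ (fun x => fderiv ℝ Φ x (EuclideanSpace.single j 1)) :=
    (hΦ.fderiv_right (m := ∞) (by simp)).clm_apply contDiff_const
  exact (contDiff_piLp 2).1 h i

theorem contDiff_det_jacobian {Φ : EuclideanSpace ℝ ι → EuclideanSpace ℝ ι}
    (hΦ : ContDiff ℝ ∞ Φ) : ContDiff ℝ ∞ fun x => (jacobian Φ x).det := by
  simp_rw [det_apply]
  refine ContDiff.sum fun σ _ => ?_
  exact (contDiff_prod fun i _ => contDiff_jacobian_apply hΦ _ _).const_smul _

theorem fderiv_jacobian_apply {Φ : EuclideanSpace ℝ ι → EuclideanSpace ℝ ι}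
    (hΦ : ContDiff ℝ ∞ Φ) (x : EuclideanSpace ℝ ι) (k l j : ι) :
    fderiv ℝ (fun y => jacobian Φ y k l) x (EuclideanSpace.single j 1) =
      fderiv ℝ (fderiv ℝ Φ) x (EuclideanSpace.single j 1) (EuclideanSpace.single l 1) k := by
  have h1 : Differentiable ℝ (fderiv ℝ Φ) :=
    (hΦ.fderiv_right (m := 1) (by norm_cast)).differentiable (by norm_num)
  have h2 : DifferentiableAt ℝ (fun y => fderiv ℝ Φ y (EuclideanSpace.single l 1)) x :=
    (h1 x).clm_apply (differentiableAt_const _)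
  change fderiv ℝ (fun y => (fderiv ℝ Φ y (EuclideanSpace.single l 1)) k) x _ = _
  rw [fderiv_euclidean_apply h2, fderiv_clm_apply (h1 x) (differentiableAt_const _)]
  simp

theorem updateRow_sum_smul_det (A : Matrix ι ι ℝ) (k : ι) (w : ι → ℝ) :
    (A.updateRow k w).det = ∑ l, w l * (A.updateRow k (Pi.single l 1)).det := by
  have h : w = ∑ l, w l • (Pi.single l 1 : ι → ℝ) := by
    ext j; simp [Finset.sum_apply, Pi.single_apply]
  conv_lhs => rw [h]
  have key := map_sum ((detRowAlternating : (ι → ℝ) [⋀^ι]→ₗ[ℝ] ℝ).toMultilinearMap.toLinearMap A k)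
    (fun l => w l • (Pi.single l 1 : ι → ℝ)) Finset.univ
  simp only [map_smul] at key
  exact key

/-- **Piola's identity**: the columns of the cofactor matrix of a Jacobian are divergence free. -/
theorem sum_fderiv_adjugate_jacobian {Φ : EuclideanSpace ℝ ι → EuclideanSpace ℝ ι}
    (hΦ : ContDiff ℝ ∞ Φ) (x : EuclideanSpace ℝ ι) (i : ι) :
    ∑ j, fderiv ℝ (fun y => (jacobian Φ y).adjugate j i) x (EuclideanSpace.single j 1) = 0 := by
  set e : ι → EuclideanSpace ℝ ι := fun j => EuclideanSpace.single j 1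
  set H : ι → ι → ι → ℝ := fun k j l => fderiv ℝ (fderiv ℝ Φ) x (e j) (e l) k with hH
  have hsymm : ∀ k j l, H k j l = H k l j := by
    intro k j l
    have := (hΦ.contDiffAt (x := x)).isSymmSndFDerivAt (by simp [ENat.LEInfty.out])
    simp only [hH, this.eq]
  have hrow : ∀ j k, DifferentiableAt ℝ
      (fun y => if k = i then (Pi.single j 1 : ι → ℝ) else fun l => jacobian Φ y k l) x := by
    intro j k
    split_ifs
    · exact differentiableAt_const _
    · exact differentiableAt_pi.2 fun l =>
        ((contDiff_jacobian_apply hΦ k l).differentiable (by simp)) x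
  -- A cofactor is a determinant whose row `i` is constant, so differentiating row by row only hits
  -- the rows `k ≠ i`.
  have hadj : ∀ j, (fun y => (jacobian Φ y).adjugate j i) = fun y => det (of fun k =>
      if k = i then (Pi.single j 1 : ι → ℝ) else fun l => jacobian Φ y k l) := by
    intro j
    ext y
    rw [adjugate_apply]
    congr 1
    ext k l
    by_cases hk : k = i
    · subst hk; simp
    · simp [hk]
  have hof : ∀ j, (of fun k => if k = i then (Pi.single j 1 : ι → ℝ)
      else fun l => jacobian Φ x k l) = (jacobian Φ x).updateRow i (Pi.single j 1) := by
    intro j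
    ext k l
    by_cases hk : k = i
    · subst hk; simp
    · simp [hk]
  have hterm : ∀ j, fderiv ℝ (fun y => (jacobian Φ y).adjugate j i) x (e j) =
      ∑ k, if k = i then 0 else ∑ l, H k j l *
        (((jacobian Φ x).updateRow i (Pi.single j 1)).updateRow k (Pi.single l 1)).det := by
    intro j
    rw [hadj, fderiv_det_rows (hrow j)]
    refine Finset.sum_congr rfl fun k _ => ?_
    rw [hof]
    split_ifs with hk
    · refine det_eq_zero_of_row_eq_zero k fun l => ?_
      simp [hk]
    · rw [updateRow_sum_smul_det]
      refine Finset.sum_congr rfl fun l _ => ?_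
      congr 1
      rw [hH]
      simp only
      rw [← fderiv_jacobian_apply hΦ, fderiv_pi
        (fun l => ((contDiff_jacobian_apply hΦ k l).differentiable (by simp)) x)]
      rfl
  rw [Finset.sum_congr rfl fun j _ => hterm j, Finset.sum_comm]
  refine Finset.sum_eq_zero fun k _ => ?_
  by_cases hk : k = i
  · simp [hk]
  simp only [hk, if_false]
  -- Exchanging rows `i` and `k` exchanges `j` and `l`: the determinant is antisymmetric in `(j,
  -- l)`, while the second derivative `H` is symmetric, so the double sum equals its own negative.
  have hanti : ∀ j l,
      (((jacobian Φ x).updateRow i (Pi.single j 1)).updateRow k (Pi.single l 1)).det =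
      - (((jacobian Φ x).updateRow i (Pi.single l 1)).updateRow k (Pi.single j 1)).det := by
    intro j l
    have := det_permute (Equiv.swap i k)
      (((jacobian Φ x).updateRow i (Pi.single l 1)).updateRow k (Pi.single j 1))
    rw [Equiv.Perm.sign_swap (Ne.symm hk)] at this
    simp only [Units.val_neg, Units.val_one, Int.cast_neg, Int.cast_one, neg_mul, one_mul] at this
    rw [← this]
    congr 1
    ext a b
    by_cases ha : a = k
    · subst ha; simp [updateRow_apply, Ne.symm hk]
    · by_cases hb : a = i
      · subst hb; simp [updateRow_apply, Ne.symm hk]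
      · simp [updateRow_apply, ha, hb, Equiv.swap_apply_of_ne_of_ne hb ha]
  have hself : ∀ S : ℝ, S = -S → S = 0 := fun S h => by linarith
  apply hself
  rw [← Finset.sum_neg_distrib]
  conv_rhs =>
    enter [2, j]
    rw [← Finset.sum_neg_distrib]
  conv_lhs => rw [Finset.sum_comm]
  refine Finset.sum_congr rfl fun l _ => Finset.sum_congr rfl fun j _ => ?_
  rw [hsymm, hanti]
  ring

/-- The pull-back of a vector field `V` by `Φ`, multiplied by the Jacobian determinant. -/
noncomputable def piolaField (Φ V : EuclideanSpace ℝ ι → EuclideanSpace ℝ ι)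
    (x : EuclideanSpace ℝ ι) : EuclideanSpace ℝ ι :=
  WithLp.toLp 2 ((jacobian Φ x).adjugate *ᵥ V (Φ x))

theorem contDiff_adjugate_jacobian_apply {Φ : EuclideanSpace ℝ ι → EuclideanSpace ℝ ι}
    (hΦ : ContDiff ℝ ∞ Φ) (j i : ι) :
    ContDiff ℝ ∞ fun x => (jacobian Φ x).adjugate j i := by
  simp_rw [adjugate_apply, det_apply]
  refine ContDiff.sum fun σ _ => (contDiff_prod fun k _ => ?_).const_smul _
  by_cases hk : σ k = i
  · simp only [hk, updateRow_self]; exact contDiff_const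
  · simp only [updateRow_ne hk]; exact contDiff_jacobian_apply hΦ _ _

theorem contDiff_piolaField {Φ V : EuclideanSpace ℝ ι → EuclideanSpace ℝ ι}
    (hΦ : ContDiff ℝ ∞ Φ) (hV : ContDiff ℝ ∞ V) : ContDiff ℝ ∞ (piolaField Φ V) := by
  rw [contDiff_piLp 2]
  intro j
  change ContDiff ℝ ∞ fun x => ∑ i, (jacobian Φ x).adjugate j i * V (Φ x) i
  exact ContDiff.sum fun i _ => (contDiff_adjugate_jacobian_apply hΦ j i).mul
    ((contDiff_piLp 2).1 (hV.comp hΦ) i)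

/-- In the product rule, the derivatives of the cofactors cancel by Piola's identity, and what
remains collapses through `DΦ * adj DΦ = det DΦ • 1`. -/
theorem divergence_piolaField {Φ V : EuclideanSpace ℝ ι → EuclideanSpace ℝ ι}
    (hΦ : ContDiff ℝ ∞ Φ) (hV : ContDiff ℝ ∞ V) (x : EuclideanSpace ℝ ι) :
    divergence (piolaField Φ V) x = divergence V (Φ x) * (jacobian Φ x).det := by
  have hdF := (contDiff_piolaField hΦ hV).differentiable (by simp) x
  have hadj : ∀ j i, DifferentiableAt ℝ (fun y => (jacobian Φ y).adjugate j i) x := fun j i =>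
    (contDiff_adjugate_jacobian_apply hΦ j i).differentiable (by simp) x
  have hdV : DifferentiableAt ℝ V (Φ x) := hV.differentiable (by simp) _
  have hdΦ : DifferentiableAt ℝ Φ x := hΦ.differentiable (by simp) _
  have hVΦ : DifferentiableAt ℝ (fun y => V (Φ y)) x := hdV.comp x hdΦ
  have hVΦi : ∀ i, DifferentiableAt ℝ (fun y => V (Φ y) i) x := fun i =>
    (differentiableAt_piLp 2).1 hVΦ i
  have hVd : ∀ i j, fderiv ℝ (fun y => V (Φ y) i) x (EuclideanSpace.single j 1) =
      ∑ k, jacobian Φ x k j * jacobian V (Φ x) i k := by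
    intro i j
    rw [fderiv_euclidean_apply hVΦ, show (fun y => V (Φ y)) = V ∘ Φ from rfl,
      fderiv_comp x hdV hdΦ, ContinuousLinearMap.comp_apply, EuclideanSpace.map_eq_sum]
    simp [jacobian, Finset.sum_apply]
  have hcomp : ∀ j, fderiv ℝ (piolaField Φ V) x (EuclideanSpace.single j 1) j =
      ∑ i, ((jacobian Φ x).adjugate j i * ∑ k, jacobian Φ x k j * jacobian V (Φ x) i k +
        V (Φ x) i * fderiv ℝ (fun y => (jacobian Φ y).adjugate j i) x
          (EuclideanSpace.single j 1)) := by
    intro j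
    rw [← fderiv_euclidean_apply hdF]
    change fderiv ℝ (fun y => ∑ i, (jacobian Φ y).adjugate j i * V (Φ y) i) x _ = _
    rw [fderiv_fun_sum fun i _ => (hadj j i).fun_mul (hVΦi i), _root_.sum_apply]
    refine Finset.sum_congr rfl fun i _ => ?_
    rw [fderiv_fun_mul (hadj j i) (hVΦi i), ← hVd]
    simp
  rw [divergence, Finset.sum_congr rfl fun j _ => hcomp j]
  simp_rw [Finset.sum_add_distrib]
  have h2 : ∑ j, ∑ i, V (Φ x) i * fderiv ℝ (fun y => (jacobian Φ y).adjugate j i) x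
      (EuclideanSpace.single j 1) = 0 := by
    rw [Finset.sum_comm]
    refine Finset.sum_eq_zero fun i _ => ?_
    rw [← Finset.mul_sum, sum_fderiv_adjugate_jacobian hΦ, mul_zero]
  rw [h2, add_zero, divergence, Finset.sum_mul, Finset.sum_comm]
  refine Finset.sum_congr rfl fun i _ => ?_
  simp_rw [Finset.mul_sum]
  rw [Finset.sum_comm]
  have hmul : ∀ k, ∑ j, (jacobian Φ x).adjugate j i * (jacobian Φ x k j * jacobian V (Φ x) i k) =
      jacobian V (Φ x) i k * ((jacobian Φ x).det * (1 : Matrix ι ι ℝ) k i) := by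
    intro k
    have := congr_fun (congr_fun (mul_adjugate (jacobian Φ x)) k) i
    rw [Matrix.smul_apply, smul_eq_mul] at this
    rw [← this, Matrix.mul_apply, Finset.mul_sum]
    exact Finset.sum_congr rfl fun j _ => by ring
  rw [Finset.sum_congr rfl fun k _ => hmul k]
  simp [Matrix.one_apply, jacobian]

/-- Integration by parts for a compactly supported function against a divergence. -/
theorem integral_mul_divergence {χ : EuclideanSpace ℝ ι → ℝ}
    {F : EuclideanSpace ℝ ι → EuclideanSpace ℝ ι} (hχ : ContDiff ℝ ∞ χ)
    (hc : HasCompactSupport χ) (hF : ContDiff ℝ ∞ F) :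
    ∫ x, χ x * divergence F x = -∫ x, fderiv ℝ χ x (F x) := by
  have hFd := hF.differentiable (by simp)
  have hFi : ∀ i, ContDiff ℝ ∞ fun x => F x i := (contDiff_piLp 2).1 hF
  have hdχ : ∀ v, Continuous fun x => fderiv ℝ χ x v := fun v =>
    (hχ.continuous_fderiv (by simp)).clm_apply continuous_const
  have hdF : ∀ i v, Continuous fun x => fderiv ℝ (fun y => F y i) x v := fun i v =>
    ((hFi i).continuous_fderiv (by simp)).clm_apply continuous_const
  have i1 : ∀ i, Integrable fun x => fderiv ℝ χ x (EuclideanSpace.single i 1) * F x i := fun i =>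
    ((hdχ _).mul (hFi i).continuous).integrable_of_hasCompactSupport
      ((hc.fderiv_apply ℝ _).mul_right)
  have i2 : ∀ i, Integrable fun x =>
      χ x * fderiv ℝ (fun y => F y i) x (EuclideanSpace.single i 1) := fun i =>
    (hχ.continuous.mul (hdF i _)).integrable_of_hasCompactSupport hc.mul_right
  have i3 : ∀ i, Integrable fun x => χ x * F x i := fun i =>
    (hχ.continuous.mul (hFi i).continuous).integrable_of_hasCompactSupport hc.mul_right
  have h1 : ∀ x, χ x * divergence F x =
      ∑ i, χ x * fderiv ℝ (fun y => F y i) x (EuclideanSpace.single i 1) := by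
    intro x
    rw [divergence, Finset.mul_sum]
    exact Finset.sum_congr rfl fun i _ => by rw [fderiv_euclidean_apply (hFd x)]
  have h2 : ∀ x, fderiv ℝ χ x (F x) =
      ∑ i, fderiv ℝ χ x (EuclideanSpace.single i 1) * F x i := by
    intro x
    rw [EuclideanSpace.map_eq_sum]
    exact Finset.sum_congr rfl fun i _ => by rw [smul_eq_mul, mul_comm]
  simp_rw [h1, h2]
  rw [integral_finsetSum _ fun i _ => i2 i, integral_finsetSum _ fun i _ => i1 i,
    ← Finset.sum_neg_distrib]
  refine Finset.sum_congr rfl fun i _ => ?_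
  exact integral_mul_fderiv_eq_neg_fderiv_mul_of_integrable (i1 i) (i2 i) (i3 i)
    (fun x _ => hχ.differentiable (by simp) x) (fun x _ => (hFi i).differentiable (by simp) x)

/-- The right side only sees `Φ` where `χ` varies. This allows `Φ` to be arbitrary inside the hole
of the shell. -/
theorem integral_mul_divergence_comp_mul_det {χ : EuclideanSpace ℝ ι → ℝ}
    {Φ V : EuclideanSpace ℝ ι → EuclideanSpace ℝ ι} (hχ : ContDiff ℝ ∞ χ)
    (hc : HasCompactSupport χ) (hΦ : ContDiff ℝ ∞ Φ) (hV : ContDiff ℝ ∞ V) :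
    ∫ x, χ x * (divergence V (Φ x) * (jacobian Φ x).det) =
      -∫ x, fderiv ℝ χ x (piolaField Φ V x) := by
  rw [← integral_mul_divergence hχ hc (contDiff_piolaField hΦ hV)]
  simp_rw [divergence_piolaField hΦ hV]

end Piola

/-! ### Symplectic maps of a collar preserve the enclosed volume. -/

section Symplectic

variable {n : ℕ}

/-- The standard symplectic form as a continuous bilinear map. -/
noncomputable def symplecticCLM (n : ℕ) : PhaseSpace n →L[ℝ] PhaseSpace n →L[ℝ] ℝ :=
  LinearMap.toContinuousBilinearMap <| LinearMap.mk₂ ℝ stdSymplecticForm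
    (fun u v w => by
      simp only [stdSymplecticForm, ← Finset.sum_add_distrib, PiLp.add_apply]
      exact Finset.sum_congr rfl fun i _ => by ring)
    (fun c v w => by
      simp only [stdSymplecticForm, smul_eq_mul, Finset.mul_sum, PiLp.smul_apply]
      exact Finset.sum_congr rfl fun i _ => by ring)
    (fun u v w => by
      simp only [stdSymplecticForm, ← Finset.sum_add_distrib, PiLp.add_apply]
      exact Finset.sum_congr rfl fun i _ => by ring)
    (fun c v w => by
      simp only [stdSymplecticForm, smul_eq_mul, Finset.mul_sum, PiLp.smul_apply]
      exact Finset.sum_congr rfl fun i _ => by ring)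

@[simp]
theorem symplecticCLM_apply (v w : PhaseSpace n) :
    symplecticCLM n v w = stdSymplecticForm v w := rfl

/-- The standard complex structure `(x, y) ↦ (-y, x)` of phase space. -/
noncomputable def complexStructure (n : ℕ) : PhaseSpace n →L[ℝ] PhaseSpace n :=
  Matrix.toEuclideanCLM (𝕜 := ℝ) (Matrix.J (Fin n) ℝ)

@[simp]
theorem complexStructure_inl (v : PhaseSpace n) (i : Fin n) :
    complexStructure n v (Sum.inl i) = -v (Sum.inr i) := by
  change ((Matrix.J (Fin n) ℝ) *ᵥ (v : Fin n ⊕ Fin n → ℝ)) (Sum.inl i) = _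
  simp [Matrix.J, Matrix.mulVec, dotProduct, Matrix.one_apply]

@[simp]
theorem complexStructure_inr (v : PhaseSpace n) (i : Fin n) :
    complexStructure n v (Sum.inr i) = v (Sum.inl i) := by
  change ((Matrix.J (Fin n) ℝ) *ᵥ (v : Fin n ⊕ Fin n → ℝ)) (Sum.inr i) = _
  simp [Matrix.J, Matrix.mulVec, dotProduct, Matrix.one_apply]

theorem stdSymplecticForm_complexStructure_right (v w : PhaseSpace n) :
    stdSymplecticForm v (complexStructure n w) = inner ℝ v w := by
  simp [stdSymplecticForm, PiLp.inner_apply, Finset.sum_add_distrib, mul_comm]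

theorem stdSymplecticForm_eq_neg_dotProduct (v w : PhaseSpace n) :
    stdSymplecticForm v w =
      -((v : Fin n ⊕ Fin n → ℝ) ⬝ᵥ (Matrix.J (Fin n) ℝ *ᵥ (w : Fin n ⊕ Fin n → ℝ))) := by
  simp [stdSymplecticForm, dotProduct, Matrix.J, Matrix.mulVec, Matrix.one_apply,
    Finset.sum_sub_distrib]
  ring

theorem inner_complexStructure_self (v : PhaseSpace n) :
    inner ℝ v (complexStructure n v) = 0 := by
  simp [PiLp.inner_apply, mul_comm]

theorem complexStructure_single_inl (i : Fin n) :
    complexStructure n (EuclideanSpace.single (Sum.inl i) 1) =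
      EuclideanSpace.single (Sum.inr i) 1 := by
  ext (j | j) <;> simp

theorem complexStructure_single_inr (i : Fin n) :
    complexStructure n (EuclideanSpace.single (Sum.inr i) 1) =
      -EuclideanSpace.single (Sum.inl i) 1 := by
  ext (j | j) <;> simp

theorem fderiv_comp_norm_sq {E : Type*} [NormedAddCommGroup E] [InnerProductSpace ℝ E]
    {k : ℝ → ℝ} (hk : Differentiable ℝ k) (x v : E) :
    fderiv ℝ (fun x => k (‖x‖ ^ 2)) x v = deriv k (‖x‖ ^ 2) * (2 * inner ℝ x v) := by
  have h : HasFDerivAt (fun x : E => ‖x‖ ^ 2) (2 • innerSL ℝ x) x :=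
    (hasStrictFDerivAt_norm_sq x).hasFDerivAt
  have := (hk (‖x‖ ^ 2)).hasDerivAt.comp_hasFDerivAt x h
  change fderiv ℝ (k ∘ fun x => ‖x‖ ^ 2) x v = _
  rw [this.fderiv]
  simp

theorem hasCompactSupport_comp_norm_sq {E : Type*} [NormedAddCommGroup E] [ProperSpace E]
    {k : ℝ → ℝ} {R : ℝ} (hR : ∀ s, R < s → k s = 0) :
    HasCompactSupport fun x : E => k (‖x‖ ^ 2) := by
  refine HasCompactSupport.intro (isCompact_closedBall 0 (|R| + 1)) fun x hx => hR _ ?_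
  rw [mem_closedBall_zero_iff, not_le] at hx
  nlinarith [le_abs_self R, abs_nonneg R]

/-- For a one-form `α` whose derivative is symmetric on the support of a radial function `k`, the
integral of `k` times `α` along the Hopf field vanishes. This uses that spheres in dimension
`2n ≥ 4` have no first cohomology. -/
theorem integral_radial_mul_closed_hopf (hn : 2 ≤ n) {α : PhaseSpace n → PhaseSpace n →L[ℝ] ℝ}
    (hα : ContDiff ℝ ∞ α) {k : ℝ → ℝ} (hk : ContDiff ℝ ∞ k)
    (hc : HasCompactSupport fun x : PhaseSpace n => k (‖x‖ ^ 2))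
    (hsymm : ∀ x : PhaseSpace n, k (‖x‖ ^ 2) ≠ 0 →
      ∀ u v, fderiv ℝ α x u v = fderiv ℝ α x v u) :
    ∫ x : PhaseSpace n, k (‖x‖ ^ 2) * α x (complexStructure n x) = 0 := by
  let J := complexStructure n
  let e : Fin n ⊕ Fin n → PhaseSpace n := fun i => EuclideanSpace.single i 1
  -- The field `Q` with these components is tangent to the spheres about `0`, and closedness of `α`
  -- turns its divergence into `(2 - 2n) α(Jx)`. Integrating by parts against a radial weight then
  -- leaves nothing.
  let q : Fin n ⊕ Fin n → PhaseSpace n → ℝ := fun i x =>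
    ‖x‖ ^ 2 * α x (J (e i)) + α x x * (J x) i - α x (J x) * x i
  let Q : PhaseSpace n → PhaseSpace n := fun x => WithLp.toLp 2 fun i => q i x
  have hcoord : ∀ i, ContDiff ℝ ∞ fun x : PhaseSpace n => x i := fun i =>
    (contDiff_piLp 2).1 contDiff_id i
  have hq : ∀ i, ContDiff ℝ ∞ (q i) := fun i =>
    (((contDiff_norm_sq ℝ).mul (hα.clm_apply contDiff_const)).add
      ((hα.clm_apply contDiff_id).mul ((hcoord i).comp J.contDiff))).sub
      ((hα.clm_apply J.contDiff).mul (hcoord i))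
  have hQ : ContDiff ℝ ∞ Q := (contDiff_piLp 2).2 hq
  have horth : ∀ x, inner ℝ x (Q x) = 0 := by
    intro x
    have h1 : ∑ i, x i * α x (J (e i)) = α x (J x) := by
      have := EuclideanSpace.map_eq_sum ((α x).comp J) x
      simpa using this.symm
    have h2 : ∑ i, x i * (J x) i = 0 := by
      rw [← inner_complexStructure_self x, PiLp.inner_apply]
      exact Finset.sum_congr rfl fun i _ => by simp [J, mul_comm]
    have h3 : ∑ i, x i * x i = ‖x‖ ^ 2 := by
      rw [EuclideanSpace.real_norm_sq_eq]
      exact Finset.sum_congr rfl fun i _ => by ring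
    have h4 : inner ℝ x (Q x) = ∑ i, (‖x‖ ^ 2 * (x i * α x (J (e i))) +
        α x x * (x i * (J x) i) - α x (J x) * (x i * x i)) := by
      rw [PiLp.inner_apply]
      refine Finset.sum_congr rfl fun i _ => ?_
      simp only [Q, q, RCLike.inner_apply, conj_trivial]
      ring
    rw [h4, Finset.sum_sub_distrib, Finset.sum_add_distrib, ← Finset.mul_sum, ← Finset.mul_sum,
      ← Finset.mul_sum, h1, h2, h3]
    ring
  have hdiv : ∀ x : PhaseSpace n, k (‖x‖ ^ 2) ≠ 0 →
      divergence Q x = (2 - 2 * n) * α x (J x) := by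
    intro x hx
    have hs := hsymm x hx
    have hαx : HasFDerivAt α (fderiv ℝ α x) x := (hα.differentiable (by simp) x).hasFDerivAt
    have hpart : ∀ i, fderiv ℝ Q x (e i) i =
        2 * (x i * α x (J (e i))) + ‖x‖ ^ 2 * fderiv ℝ α x (e i) (J (e i)) +
        ((J x) i * fderiv ℝ α x (e i) x + (J x) i * α x (e i)) -
        (x i * fderiv ℝ α x (e i) (J x) + x i * α x (J (e i))) - α x (J x) := by
      intro i
      rw [← fderiv_euclidean_apply (hQ.differentiable (by simp) x)]
      have hn2 : HasFDerivAt (fun x : PhaseSpace n => ‖x‖ ^ 2) (2 • innerSL ℝ x) x :=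
        (hasStrictFDerivAt_norm_sq x).hasFDerivAt
      have hp : ∀ y : PhaseSpace n, HasFDerivAt (fun y : PhaseSpace n => y i)
          (EuclideanSpace.proj (𝕜 := ℝ) i : PhaseSpace n →L[ℝ] ℝ) y := fun y =>
        (EuclideanSpace.proj (𝕜 := ℝ) i : PhaseSpace n →L[ℝ] ℝ).hasFDerivAt
      have hJ : HasFDerivAt (fun y => J y) J x := J.hasFDerivAt
      have h := ((hn2.fun_mul (hαx.clm_apply (hasFDerivAt_const (J (e i)) x))).fun_add
        ((hαx.clm_apply (hasFDerivAt_id x)).fun_mul ((hp (J x)).comp x hJ))).fun_sub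
        ((hαx.clm_apply hJ).fun_mul (hp x))
      have hJe : (J (e i)) i = 0 := by
        rcases i with i | i <;> simp [J, e]
      have hin : inner ℝ x (e i) = x i := by
        simp [e, EuclideanSpace.inner_single_right]
      have he : (e i) i = 1 := by simp [e]
      change fderiv ℝ (q i) x (e i) = _
      rw [show fderiv ℝ (q i) x = _ from h.fderiv]
      simp [hJe, hin, he]
      ring
    have h1 : ∑ i, x i * α x (J (e i)) = α x (J x) := by
      have := EuclideanSpace.map_eq_sum ((α x).comp J) x
      simpa using this.symm
    have h2 : ∑ i, (J x) i * α x (e i) = α x (J x) := by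
      have := EuclideanSpace.map_eq_sum (α x) (J x)
      simpa using this.symm
    have h3 : ∀ v w, ∑ i, v i * fderiv ℝ α x (e i) w = fderiv ℝ α x v w := by
      intro v w
      have := EuclideanSpace.map_eq_sum ((fderiv ℝ α x).flip w) v
      simpa using this.symm
    have h4 : ∑ i, fderiv ℝ α x (e i) (J (e i)) = 0 := by
      rw [Fintype.sum_sum_type, ← Finset.sum_add_distrib]
      refine Finset.sum_eq_zero fun i _ => ?_
      simp only [J, e, complexStructure_single_inl, complexStructure_single_inr, map_neg]
      rw [hs]
      ring
    rw [divergence, Finset.sum_congr rfl fun i _ => hpart i]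
    simp only [Finset.sum_sub_distrib, Finset.sum_add_distrib, ← Finset.mul_sum, h1, h2, h3, h4]
    rw [hs (J x) x]
    simp
    ring
  have key := integral_mul_divergence (hk.comp (contDiff_norm_sq ℝ)) hc hQ
  have hr : ∀ x, fderiv ℝ (fun x : PhaseSpace n => k (‖x‖ ^ 2)) x (Q x) = 0 := by
    intro x
    rw [fderiv_comp_norm_sq (hk.differentiable (by simp)), horth]
    ring
  have hl : ∀ x : PhaseSpace n, k (‖x‖ ^ 2) * divergence Q x =
      (2 - 2 * n) * (k (‖x‖ ^ 2) * α x (J x)) := by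
    intro x
    by_cases hx : k (‖x‖ ^ 2) = 0
    · simp [hx]
    · rw [hdiv x hx]; ring
  simp only [Function.comp_def, hr, hl, integral_zero, neg_zero] at key
  rw [integral_const_mul] at key
  -- Here `n ≥ 2` is indispensable: the factor `2 - 2n` vanishes for `n = 1`.
  refine (mul_eq_zero.1 key).resolve_left ?_
  have : (2 : ℝ) ≤ n := by exact_mod_cast hn
  linarith

theorem jacobian_mulVec {ι : Type*} [Fintype ι] [DecidableEq ι]
    (Φ : EuclideanSpace ℝ ι → EuclideanSpace ℝ ι) (x v : EuclideanSpace ℝ ι) :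
    jacobian Φ x *ᵥ (v : ι → ℝ) = fderiv ℝ Φ x v := by
  ext i
  rw [EuclideanSpace.map_eq_sum]
  simp [jacobian, Matrix.mulVec, dotProduct, mul_comm]

/-- The derivative of `Φ` at `x` preserves the standard symplectic form. -/
def IsSymplecticAt (Φ : PhaseSpace n → PhaseSpace n) (x : PhaseSpace n) : Prop :=
  ∀ v w, stdSymplecticForm (fderiv ℝ Φ x v) (fderiv ℝ Φ x w) = stdSymplecticForm v w

theorem IsSymplecticAt.det_jacobian {Φ : PhaseSpace n → PhaseSpace n} {x : PhaseSpace n}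
    (h : IsSymplecticAt Φ x) : (jacobian Φ x).det = 1 := by
  apply SymplecticGroup.det_eq_one
  rw [SymplecticGroup.mem_iff']
  have key : ∀ v w : Fin n ⊕ Fin n → ℝ,
      v ⬝ᵥ (((jacobian Φ x)ᵀ * Matrix.J (Fin n) ℝ * jacobian Φ x) *ᵥ w) =
        v ⬝ᵥ (Matrix.J (Fin n) ℝ *ᵥ w) := by
    intro v w
    have := h (WithLp.toLp 2 v) (WithLp.toLp 2 w)
    rw [stdSymplecticForm_eq_neg_dotProduct, stdSymplecticForm_eq_neg_dotProduct, neg_inj,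
      ← jacobian_mulVec, ← jacobian_mulVec] at this
    rw [← Matrix.mulVec_mulVec, ← Matrix.mulVec_mulVec, Matrix.dotProduct_mulVec,
      Matrix.vecMul_transpose]
    exact this
  ext i j
  simpa using key (Pi.single i 1) (Pi.single j 1)

/-- As the determinant is `1`, `piolaField Φ V x` is the preimage of `V (Φ x)` under `DΦ`. Pairing
it with `x` is applying `ω(·, Jx)`, and `DΦ` preserves ω. -/
theorem IsSymplecticAt.inner_piolaField {Φ : PhaseSpace n → PhaseSpace n} {x : PhaseSpace n}
    (h : IsSymplecticAt Φ x) (V : PhaseSpace n → PhaseSpace n) :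
    inner ℝ x (piolaField Φ V x) =
      stdSymplecticForm (V (Φ x)) (fderiv ℝ Φ x (complexStructure n x)) := by
  have hv : fderiv ℝ Φ x (piolaField Φ V x) = V (Φ x) := by
    ext i
    rw [← jacobian_mulVec]
    simp [piolaField, Matrix.mulVec_mulVec, Matrix.mul_adjugate, h.det_jacobian]
  rw [← hv, h, stdSymplecticForm_complexStructure_right, real_inner_comm]

theorem divergence_id {ι : Type*} [Fintype ι] [DecidableEq ι] (x : EuclideanSpace ℝ ι) :
    divergence (fun y => y) x = Fintype.card ι := by
  simp [divergence]

theorem jacobian_id {ι : Type*} [Fintype ι] [DecidableEq ι] (x : EuclideanSpace ℝ ι) :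
    jacobian (fun y => y) x = 1 := by
  ext i j
  simp [jacobian, Matrix.one_apply]

theorem isSymplecticAt_id (x : PhaseSpace n) : IsSymplecticAt (fun y => y) x := by
  intro v w
  simp

/-- If `Φ` is symplectic where a radial cut-off function varies, then it preserves the volume
measured by the cut-off function, whatever `Φ` is elsewhere. -/
theorem integral_radial_mul_det_jacobian (hn : 2 ≤ n) {Φ : PhaseSpace n → PhaseSpace n}
    (hΦ : ContDiff ℝ ∞ Φ) {k : ℝ → ℝ} (hk : ContDiff ℝ ∞ k)
    {R : ℝ} (hR : ∀ s, R < s → k s = 0)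
    (hsymp : ∀ x : PhaseSpace n, deriv k (‖x‖ ^ 2) ≠ 0 → IsSymplecticAt Φ x) :
    ∫ x : PhaseSpace n, k (‖x‖ ^ 2) * (jacobian Φ x).det =
      ∫ x : PhaseSpace n, k (‖x‖ ^ 2) := by
  have hk' : ContDiff ℝ ∞ (deriv k) := hk.deriv'
  have hkd := hk.differentiable (by simp)
  have hR' : ∀ s, R < s → deriv k s = 0 := fun s hs => by
    have : k =ᶠ[𝓝 s] fun _ => 0 := by
      filter_upwards [lt_mem_nhds hs] with t ht using hR t ht
    rw [this.deriv_eq]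
    simp
  have hc := hasCompactSupport_comp_norm_sq (E := PhaseSpace n) hR
  have hc' := hasCompactSupport_comp_norm_sq (E := PhaseSpace n) hR'
  -- Stokes with the Euler field `V = id`, of divergence `2n`: volume becomes an integral over the
  -- collar where `k` varies. It is applied to `Φ` and to the identity, whose boundary terms are
  -- then compared.
  have hgen : ∀ Ψ : PhaseSpace n → PhaseSpace n, ContDiff ℝ ∞ Ψ →
      (∀ x : PhaseSpace n, deriv k (‖x‖ ^ 2) ≠ 0 → IsSymplecticAt Ψ x) →
      ∫ x : PhaseSpace n, k (‖x‖ ^ 2) * ((2 * n) * (jacobian Ψ x).det) =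
        - ∫ x : PhaseSpace n, 2 * (deriv k (‖x‖ ^ 2) *
          stdSymplecticForm (Ψ x) (fderiv ℝ Ψ x (complexStructure n x))) := by
    intro Ψ hΨ hs
    have := integral_mul_divergence_comp_mul_det (hk.comp (contDiff_norm_sq ℝ)) hc hΨ
      (V := fun y => y) contDiff_id
    simp only [divergence_id, Function.comp_def, fderiv_comp_norm_sq hkd] at this
    convert this using 2
    · ext x
      simp only [Fintype.card_sum, Fintype.card_fin, Nat.cast_add]
      ring
    · refine integral_congr_ae (Filter.Eventually.of_forall fun x => ?_)
      by_cases hx : deriv k (‖x‖ ^ 2) = 0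
      · simp [hx]
      · simp only [(hs x hx).inner_piolaField]
        ring
  have h1 := hgen Φ hΦ hsymp
  have h2 := hgen (fun y => y) contDiff_id fun x _ => isSymplecticAt_id x
  -- With `β = ω(x, ·)`, a primitive of `2ω`, this is `Φ^*β - β`; it is closed wherever `Φ` is
  -- symplectic.
  let α : PhaseSpace n → PhaseSpace n →L[ℝ] ℝ := fun x =>
    (symplecticCLM n (Φ x)).comp (fderiv ℝ Φ x) - symplecticCLM n x
  have hdΦ : ContDiff ℝ ∞ (fderiv ℝ Φ) := hΦ.fderiv_right (by simp)
  have hα : ContDiff ℝ ∞ α :=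
    (((symplecticCLM n).contDiff.comp hΦ).clm_comp hdΦ).sub (symplecticCLM n).contDiff
  have hsymm : ∀ x : PhaseSpace n, deriv k (‖x‖ ^ 2) ≠ 0 →
      ∀ u v, fderiv ℝ α x u v = fderiv ℝ α x v u := by
    intro x hx u v
    have hs : IsSymplecticAt Φ x := hsymp x hx
    have hd1 : HasFDerivAt Φ (fderiv ℝ Φ x) x := (hΦ.differentiable (by simp) x).hasFDerivAt
    have hd2 : HasFDerivAt (fderiv ℝ Φ) (fderiv ℝ (fderiv ℝ Φ) x) x :=
      (hdΦ.differentiable (by simp) x).hasFDerivAt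
    have hd3 : HasFDerivAt (fun y => symplecticCLM n (Φ y)) _ x :=
      (symplecticCLM n).hasFDerivAt.comp x hd1
    have hα' := (hd3.clm_comp hd2).fun_sub (symplecticCLM n).hasFDerivAt
    have hsym2 : fderiv ℝ (fderiv ℝ Φ) x u v = fderiv ℝ (fderiv ℝ Φ) x v u :=
      (hΦ.contDiffAt (x := x)).isSymmSndFDerivAt (by simp [ENat.LEInfty.out]) u v
    rw [show fderiv ℝ α x = _ from hα'.fderiv]
    simp [hs u v, hs v u, hsym2]
  have h3 := integral_radial_mul_closed_hopf hn hα hk' hc' hsymm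
  have hJc : Continuous fun x => complexStructure n x := (complexStructure n).continuous
  have hk'c : Continuous fun x : PhaseSpace n => deriv k (‖x‖ ^ 2) :=
    hk'.continuous.comp (by fun_prop)
  have i1 : Integrable fun x : PhaseSpace n => deriv k (‖x‖ ^ 2) *
      stdSymplecticForm (Φ x) (fderiv ℝ Φ x (complexStructure n x)) := by
    refine Continuous.integrable_of_hasCompactSupport (hk'c.mul ?_) hc'.mul_right
    exact (((symplecticCLM n).continuous.comp hΦ.continuous).clm_apply
      (hdΦ.continuous.clm_apply hJc))
  have i2 : Integrable fun x : PhaseSpace n => deriv k (‖x‖ ^ 2) *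
      stdSymplecticForm x (complexStructure n x) := by
    refine Continuous.integrable_of_hasCompactSupport (hk'c.mul ?_) hc'.mul_right
    exact (symplecticCLM n).continuous.clm_apply hJc
  have h4 : ∫ x : PhaseSpace n, deriv k (‖x‖ ^ 2) *
      stdSymplecticForm (Φ x) (fderiv ℝ Φ x (complexStructure n x)) =
      ∫ x : PhaseSpace n, deriv k (‖x‖ ^ 2) * stdSymplecticForm x (complexStructure n x) := by
    rw [← sub_eq_zero, ← integral_sub i1 i2, ← h3]
    congr 1
    ext x
    simp [α]
    ring
  simp only [jacobian_id, det_one, fderiv_fun_id, ContinuousLinearMap.id_apply,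
    integral_const_mul] at h1 h2
  rw [h4, ← h2] at h1
  have hl : ∀ f : PhaseSpace n → ℝ, ∫ x : PhaseSpace n, k (‖x‖ ^ 2) * (2 * n * f x) =
      2 * n * ∫ x : PhaseSpace n, k (‖x‖ ^ 2) * f x := by
    intro f
    rw [← integral_const_mul]
    congr 1
    ext x
    ring
  rw [hl, hl (fun _ => 1)] at h1
  have : (n : ℝ) ≠ 0 := by positivity
  simpa [this] using h1

end Symplectic

/-! ### Mollified mapping degree. -/

section SmoothedDegree

variable {ι : Type*} [Fintype ι]

/-- `g` is a smooth probability density vanishing outside the open ball of radius `ρ` about `0`. -/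
structure IsMollifier (g : EuclideanSpace ℝ ι → ℝ) (ρ : ℝ) : Prop where
  contDiff : ContDiff ℝ ∞ g
  nonneg : ∀ z, 0 ≤ g z
  eq_zero : ∀ z, ρ ≤ ‖z‖ → g z = 0
  integral_eq_one : ∫ z, g z = 1

theorem exists_isMollifier {ρ : ℝ} (hρ : 0 < ρ) :
    ∃ g : EuclideanSpace ℝ ι → ℝ, IsMollifier g ρ := by
  let f : ContDiffBump (0 : EuclideanSpace ℝ ι) := ⟨ρ / 2, ρ, by positivity, by linarith⟩
  refine ⟨f.normed volume, f.contDiff_normed, f.nonneg_normed, fun z hz => ?_, f.integral_normed⟩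
  rw [← Function.notMem_support, f.support_normed_eq, mem_ball_zero_iff, not_lt]
  exact hz

theorem IsMollifier.hasCompactSupport {g : EuclideanSpace ℝ ι → ℝ} {ρ : ℝ}
    (hg : IsMollifier g ρ) : HasCompactSupport g :=
  HasCompactSupport.intro (isCompact_closedBall 0 ρ) fun z hz => hg.eq_zero z <| by
    rw [mem_closedBall_zero_iff, not_le] at hz
    exact hz.le

theorem IsMollifier.integral_sub {g : EuclideanSpace ℝ ι → ℝ} {ρ : ℝ}
    (hg : IsMollifier g ρ) (p : EuclideanSpace ℝ ι) : ∫ z, g (z - p) = 1 := by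
  rw [integral_sub_right_eq_self g p, hg.integral_eq_one]

theorem IsMollifier.integrable_sub {g : EuclideanSpace ℝ ι → ℝ} {ρ : ℝ}
    (hg : IsMollifier g ρ) (p : EuclideanSpace ℝ ι) : Integrable fun z => g (z - p) :=
  (hg.contDiff.continuous.integrable_of_hasCompactSupport hg.hasCompactSupport).comp_sub_right p

variable [DecidableEq ι]

/-- The mapping degree of `Φ` over `p`, weighted by the cut-off function `χ` on the source and
averaged over the target with the weight `g`. -/
noncomputable def smoothedDegree (g χ : EuclideanSpace ℝ ι → ℝ)
    (Φ : EuclideanSpace ℝ ι → EuclideanSpace ℝ ι) (p : EuclideanSpace ℝ ι) : ℝ :=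
  ∫ x, χ x * (g (Φ x - p) * (jacobian Φ x).det)

variable {g χ : EuclideanSpace ℝ ι → ℝ} {Φ : EuclideanSpace ℝ ι → EuclideanSpace ℝ ι} {ρ : ℝ}

theorem integrable_smoothedDegree (hg : IsMollifier g ρ) (hχ : ContDiff ℝ ∞ χ)
    (hc : HasCompactSupport χ) (hΦ : ContDiff ℝ ∞ Φ) (p : EuclideanSpace ℝ ι) :
    Integrable fun x => χ x * (g (Φ x - p) * (jacobian Φ x).det) :=
  (hχ.continuous.mul ((hg.contDiff.continuous.comp (hΦ.continuous.sub continuous_const)).mul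
    (contDiff_det_jacobian hΦ).continuous)).integrable_of_hasCompactSupport hc.mul_right

theorem hasFDerivAt_smoothedDegree (hg : IsMollifier g ρ) (hχ : ContDiff ℝ ∞ χ)
    (hc : HasCompactSupport χ) (hΦ : ContDiff ℝ ∞ Φ) (p : EuclideanSpace ℝ ι) :
    HasFDerivAt (smoothedDegree g χ Φ)
      (∫ x, (-(χ x * (jacobian Φ x).det)) • fderiv ℝ g (Φ x - p)) p := by
  have hdg : Continuous (fderiv ℝ g) := hg.contDiff.continuous_fderiv (by simp)
  have hdet := (contDiff_det_jacobian hΦ).continuous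
  obtain ⟨C, hC⟩ := hdg.bounded_above_of_compact_support (hg.hasCompactSupport.fderiv ℝ)
  refine hasFDerivAt_integral_of_dominated_of_fderiv_le
    (bound := fun x => ‖χ x * (jacobian Φ x).det‖ * C)
    (F' := fun p x => (-(χ x * (jacobian Φ x).det)) • fderiv ℝ g (Φ x - p))
    (s := univ) Filter.univ_mem
    (Filter.Eventually.of_forall fun q =>
      (integrable_smoothedDegree hg hχ hc hΦ q).aestronglyMeasurable)
    (integrable_smoothedDegree hg hχ hc hΦ p) ?_ ?_ ?_ ?_
  · exact ((hχ.continuous.mul hdet).neg.smul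
      (hdg.comp (hΦ.continuous.sub continuous_const))).aestronglyMeasurable
  · refine Filter.Eventually.of_forall fun x q _ => ?_
    rw [norm_smul, norm_neg]
    exact mul_le_mul_of_nonneg_left (hC _) (norm_nonneg _)
  · exact ((hχ.continuous.mul hdet).norm.integrable_of_hasCompactSupport
      hc.mul_right.norm).mul_const C
  · refine Filter.Eventually.of_forall fun x q _ => ?_
    have h1 : HasFDerivAt (fun q => Φ x - q) (-ContinuousLinearMap.id ℝ _) q :=
      (hasFDerivAt_id q).const_sub (Φ x)
    have h2 := ((hg.contDiff.differentiable (by simp) (Φ x - q)).hasFDerivAt.comp q h1)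
    have h3 := (h2.mul_const ((jacobian Φ x).det)).const_mul (χ x)
    convert! h3 using 1
    ext v
    simp
    ring

/-- The derivative in direction `v` is minus the integral of `χ` times the pulled-back divergence of
`V = g(· - p) v`. Integration by parts moves it onto the derivative of `χ`, and `V (Φ x) = 0`
wherever that derivative is nonzero. -/
theorem fderiv_smoothedDegree_eq_zero (hg : IsMollifier g ρ) (hχ : ContDiff ℝ ∞ χ)
    (hc : HasCompactSupport χ) (hΦ : ContDiff ℝ ∞ Φ) {p : EuclideanSpace ℝ ι}
    (hp : ∀ x, fderiv ℝ χ x ≠ 0 → ρ ≤ ‖Φ x - p‖) :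
    fderiv ℝ (smoothedDegree g χ Φ) p = 0 := by
  rw [(hasFDerivAt_smoothedDegree hg hχ hc hΦ p).fderiv]
  have hdg : Continuous (fderiv ℝ g) := hg.contDiff.continuous_fderiv (by simp)
  have hdet := (contDiff_det_jacobian hΦ).continuous
  ext v
  have hint : Integrable fun x => (-(χ x * (jacobian Φ x).det)) • fderiv ℝ g (Φ x - p) :=
    ((hχ.continuous.mul hdet).neg.smul
      (hdg.comp (hΦ.continuous.sub continuous_const))).integrable_of_hasCompactSupport
      hc.mul_right.neg.smul_right
  rw [ContinuousLinearMap.integral_apply hint, _root_.zero_apply]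
  let V : EuclideanSpace ℝ ι → EuclideanSpace ℝ ι := fun z => g (z - p) • v
  have hgp : ContDiff ℝ ∞ fun z => g (z - p) := hg.contDiff.comp (contDiff_id.sub contDiff_const)
  have hV : ContDiff ℝ ∞ V := hgp.smul contDiff_const
  have hdiv : ∀ z, divergence V z = fderiv ℝ g (z - p) v := by
    intro z
    rw [divergence, EuclideanSpace.map_eq_sum (fderiv ℝ g (z - p)) v]
    refine Finset.sum_congr rfl fun i _ => ?_
    have h1 : HasFDerivAt (fun z => g (z - p)) (fderiv ℝ g (z - p)) z := by
      have := (hg.contDiff.differentiable (by simp) (z - p)).hasFDerivAt.comp z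
        ((hasFDerivAt_id z).sub_const p)
      simpa using! this
    rw [show fderiv ℝ V z = _ from (h1.smul_const v).fderiv]
    simp [mul_comm]
  have key := integral_mul_divergence_comp_mul_det hχ hc hΦ hV
  have h0 : ∀ x, fderiv ℝ χ x (piolaField Φ V x) = 0 := by
    intro x
    by_cases hx : fderiv ℝ χ x = 0
    · simp [hx]
    · have : V (Φ x) = 0 := by simp [V, hg.eq_zero _ (hp x hx)]
      simp [piolaField, this]
  simp only [h0, hdiv, integral_zero, neg_zero] at key
  rw [← neg_eq_zero, ← integral_neg, ← key]
  congr 1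
  ext x
  simp
  ring

theorem continuous_smoothedDegree (hg : IsMollifier g ρ) (hχ : ContDiff ℝ ∞ χ)
    (hc : HasCompactSupport χ) (hΦ : ContDiff ℝ ∞ Φ) : Continuous (smoothedDegree g χ Φ) :=
  continuous_iff_continuousAt.2 fun p => (hasFDerivAt_smoothedDegree hg hχ hc hΦ p).continuousAt

theorem smoothedDegree_eq_zero (hg : IsMollifier g ρ) {R : ℝ} (hR : ∀ x, ‖Φ x‖ ≤ R)
    {p : EuclideanSpace ℝ ι} (hp : R + ρ ≤ ‖p‖) : smoothedDegree g χ Φ p = 0 := by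
  rw [smoothedDegree, ← integral_zero (EuclideanSpace ℝ ι) ℝ]
  congr 1
  ext x
  rw [hg.eq_zero]
  · simp
  · have := norm_sub_norm_le p (Φ x)
    rw [norm_sub_rev] at this
    linarith [hR x]

theorem integrable_smoothedDegree_target (hg : IsMollifier g ρ) (hχ : ContDiff ℝ ∞ χ)
    (hc : HasCompactSupport χ) (hΦ : ContDiff ℝ ∞ Φ) {R : ℝ} (hR : ∀ x, ‖Φ x‖ ≤ R) :
    Integrable (smoothedDegree g χ Φ) := by
  refine (continuous_smoothedDegree hg hχ hc hΦ).integrable_of_hasCompactSupport ?_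
  refine HasCompactSupport.intro (isCompact_closedBall 0 (R + ρ)) fun p hp => ?_
  rw [mem_closedBall_zero_iff, not_le] at hp
  exact smoothedDegree_eq_zero hg hR hp.le

/-- By Fubini, as `g` has total mass `1`; boundedness of `Φ` makes the integrand compactly supported
in `p` too. -/
theorem integral_smoothedDegree (hg : IsMollifier g ρ) (hχ : ContDiff ℝ ∞ χ)
    (hc : HasCompactSupport χ) (hΦ : ContDiff ℝ ∞ Φ) {R : ℝ} (hR : ∀ x, ‖Φ x‖ ≤ R) :
    ∫ p, smoothedDegree g χ Φ p = ∫ x, χ x * (jacobian Φ x).det := by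
  have hdet := (contDiff_det_jacobian hΦ).continuous
  have hint : Integrable (Function.uncurry fun p x => χ x * (g (Φ x - p) * (jacobian Φ x).det))
      ((volume : Measure (EuclideanSpace ℝ ι)).prod volume) := by
    refine Continuous.integrable_of_hasCompactSupport ?_ ?_
    · exact (hχ.continuous.comp continuous_snd).mul ((hg.contDiff.continuous.comp
        ((hΦ.continuous.comp continuous_snd).sub continuous_fst)).mul (hdet.comp continuous_snd))
    · refine HasCompactSupport.intro ((isCompact_closedBall 0 (R + ρ)).prod hc) ?_
      rintro ⟨p, x⟩ hpx
      rw [mem_prod, not_and_or] at hpx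
      rcases hpx with hp | hx
      · rw [mem_closedBall_zero_iff, not_le] at hp
        have := norm_sub_norm_le p (Φ x)
        rw [norm_sub_rev] at this
        have h0 := hg.eq_zero (Φ x - p) (by linarith [hR x])
        simp [h0]
      · simp [image_eq_zero_of_notMem_tsupport hx]
  unfold smoothedDegree
  rw [integral_integral_swap hint]
  congr 1
  ext x
  rw [integral_const_mul, integral_mul_const, integral_sub_left_eq_self g volume (Φ x),
    hg.integral_eq_one, one_mul]

end SmoothedDegree

/-! ### Smooth radial cut-offs. -/

section RadialCutoff

/-- A smooth function of `s = ‖x‖²` equal to `1` for `‖x‖ ≤ a` and to `0` for `b ≤ ‖x‖`. -/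
noncomputable def radialCutoff (a b s : ℝ) : ℝ :=
  1 - Real.smoothTransition ((s - a ^ 2) / (b ^ 2 - a ^ 2))

theorem contDiff_radialCutoff (a b : ℝ) : ContDiff ℝ ∞ (radialCutoff a b) :=
  contDiff_const.sub (Real.smoothTransition.contDiff.comp
    ((contDiff_id.sub contDiff_const).div_const _))

theorem radialCutoff_nonneg (a b s : ℝ) : 0 ≤ radialCutoff a b s :=
  sub_nonneg.2 (Real.smoothTransition.le_one _)

theorem radialCutoff_le_one (a b s : ℝ) : radialCutoff a b s ≤ 1 :=
  sub_le_self _ (Real.smoothTransition.nonneg _)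

variable {a b : ℝ}

theorem radialCutoff_of_le (ha : 0 < a) (hab : a < b) {s : ℝ} (hs : s ≤ a ^ 2) :
    radialCutoff a b s = 1 := by
  have : a ^ 2 < b ^ 2 := by gcongr
  rw [radialCutoff, Real.smoothTransition.zero_of_nonpos, sub_zero]
  exact div_nonpos_of_nonpos_of_nonneg (by linarith) (by linarith)

theorem radialCutoff_of_ge (ha : 0 < a) (hab : a < b) {s : ℝ} (hs : b ^ 2 ≤ s) :
    radialCutoff a b s = 0 := by
  have : a ^ 2 < b ^ 2 := by gcongr
  rw [radialCutoff, Real.smoothTransition.one_of_one_le, sub_self]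
  rw [le_div_iff₀ (by linarith)]
  linarith

theorem deriv_radialCutoff_of_notMem (ha : 0 < a) (hab : a < b) {s : ℝ}
    (hs : s ∉ Icc (a ^ 2) (b ^ 2)) : deriv (radialCutoff a b) s = 0 := by
  rw [mem_Icc, not_and_or, not_le, not_le] at hs
  rcases hs with hs | hs
  · have : radialCutoff a b =ᶠ[𝓝 s] fun _ => 1 := by
      filter_upwards [gt_mem_nhds hs] with t ht using radialCutoff_of_le ha hab ht.le
    rw [this.deriv_eq]
    simp
  · have : radialCutoff a b =ᶠ[𝓝 s] fun _ => 0 := by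
      filter_upwards [lt_mem_nhds hs] with t ht using radialCutoff_of_ge ha hab ht.le
    rw [this.deriv_eq]
    simp

variable {E : Type*} [NormedAddCommGroup E]

theorem deriv_radialCutoff_norm_sq (ha : 0 < a) (hab : a < b) {x : E}
    (hx : deriv (radialCutoff a b) (‖x‖ ^ 2) ≠ 0) : a ≤ ‖x‖ ∧ ‖x‖ ≤ b := by
  have h := not_imp_comm.1 (deriv_radialCutoff_of_notMem ha hab) hx
  exact ⟨le_of_sq_le_sq h.1 (norm_nonneg _), le_of_sq_le_sq h.2 (by linarith)⟩

theorem fderiv_radialCutoff_norm_sq [InnerProductSpace ℝ E] (ha : 0 < a) (hab : a < b) {x : E}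
    (hx : fderiv ℝ (fun x : E => radialCutoff a b (‖x‖ ^ 2)) x ≠ 0) : a ≤ ‖x‖ ∧ ‖x‖ ≤ b := by
  apply deriv_radialCutoff_norm_sq ha hab
  contrapose! hx
  ext v
  rw [fderiv_comp_norm_sq ((contDiff_radialCutoff a b).differentiable (by simp)), hx]
  simp

theorem hasCompactSupport_radialCutoff [ProperSpace E] (ha : 0 < a) (hab : a < b) :
    HasCompactSupport fun x : E => radialCutoff a b (‖x‖ ^ 2) :=
  hasCompactSupport_comp_norm_sq fun _ hs => radialCutoff_of_ge ha hab hs.le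

theorem contDiff_radialCutoff_norm_sq [InnerProductSpace ℝ E] :
    ContDiff ℝ ∞ fun x : E => radialCutoff a b (‖x‖ ^ 2) :=
  (contDiff_radialCutoff a b).comp (contDiff_norm_sq ℝ)

theorem volume_closedBall_le_integral_radialCutoff [InnerProductSpace ℝ E] [FiniteDimensional ℝ E]
    [MeasurableSpace E] [BorelSpace E] (ha : 0 < a) (hab : a < b) :
    volume.real (closedBall (0 : E) a) ≤ ∫ x : E, radialCutoff a b (‖x‖ ^ 2) := by
  rw [← integral_indicator_one measurableSet_closedBall]
  refine integral_mono_of_nonneg (Filter.Eventually.of_forall fun x => ?_)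
    (contDiff_radialCutoff_norm_sq.continuous.integrable_of_hasCompactSupport
      (hasCompactSupport_radialCutoff ha hab)) (Filter.Eventually.of_forall fun x => ?_)
  · exact indicator_nonneg (fun _ _ => zero_le_one) x
  · by_cases hx : x ∈ closedBall (0 : E) a
    · rw [mem_closedBall_zero_iff] at hx
      simp [radialCutoff_of_le ha hab (show ‖x‖ ^ 2 ≤ a ^ 2 by gcongr), indicator, hx]
    · simpa [indicator, hx] using radialCutoff_nonneg a b _

theorem integral_radialCutoff_le_volume_closedBall [InnerProductSpace ℝ E] [FiniteDimensional ℝ E]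
    [MeasurableSpace E] [BorelSpace E] (ha : 0 < a) (hab : a < b) :
    ∫ x : E, radialCutoff a b (‖x‖ ^ 2) ≤ volume.real (closedBall (0 : E) b) := by
  rw [← integral_indicator_one measurableSet_closedBall]
  refine integral_mono (contDiff_radialCutoff_norm_sq.continuous.integrable_of_hasCompactSupport
      (hasCompactSupport_radialCutoff ha hab)) ?_ fun x => ?_
  · exact (integrable_indicator_iff measurableSet_closedBall).2
      (integrableOn_const measure_closedBall_lt_top.ne)
  · by_cases hx : x ∈ closedBall (0 : E) b
    · simpa [indicator_of_mem hx] using radialCutoff_le_one a b _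
    · rw [mem_closedBall_zero_iff, not_le] at hx
      simp only
      rw [radialCutoff_of_ge ha hab (by have := ha.trans hab; gcongr)]
      exact indicator_nonneg (fun _ _ => zero_le_one) x

end RadialCutoff

/-! ### Degrees of the boundary collars of a symplectically embedded shell. -/

section Shell

variable {n : ℕ} {Φ : PhaseSpace n → PhaseSpace n}

theorem isPreconnected_shell {E : Type*} [NormedAddCommGroup E] [NormedSpace ℝ E]
    (h : 1 < Module.rank ℝ E) {a b : ℝ} (ha : 0 < a) :
    IsPreconnected {x : E | a ≤ ‖x‖ ∧ ‖x‖ ≤ b} := by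
  have : {x : E | a ≤ ‖x‖ ∧ ‖x‖ ≤ b} =
      (fun p : ℝ × E => p.1 • p.2) '' (Icc a b ×ˢ sphere (0 : E) 1) := by
    ext x
    constructor
    · rintro ⟨h1, h2⟩
      have hx : ‖x‖ ≠ 0 := by linarith
      refine ⟨(‖x‖, ‖x‖⁻¹ • x), ⟨⟨h1, h2⟩, ?_⟩, ?_⟩
      · simp [norm_smul, hx]
      · simp [smul_smul, hx]
    · rintro ⟨⟨t, y⟩, ⟨⟨h1, h2⟩, hy⟩, rfl⟩
      simp only [mem_sphere_iff_norm, sub_zero] at hy h1 h2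
      simp only [mem_ofPred_eq, norm_smul, hy, mul_one, Real.norm_eq_abs,
        abs_of_pos (ha.trans_le h1)]
      exact ⟨h1, h2⟩
  rw [this]
  exact (isPreconnected_Icc.prod (isPreconnected_sphere h 0 1)).image _
    continuous_smul.continuousOn

theorem isCompact_shell {E : Type*} [NormedAddCommGroup E] [ProperSpace E] {a b : ℝ} :
    IsCompact {x : E | a ≤ ‖x‖ ∧ ‖x‖ ≤ b} := by
  refine (isCompact_closedBall (0 : E) b).of_isClosed_subset ?_ fun x hx => by simpa using hx.2
  exact (isClosed_le continuous_const continuous_norm).inter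
    (isClosed_le continuous_norm continuous_const)

theorem det_fderiv_eq_det_jacobian {ι : Type*} [Fintype ι] [DecidableEq ι]
    (Φ : EuclideanSpace ℝ ι → EuclideanSpace ℝ ι) (x : EuclideanSpace ℝ ι) :
    (fderiv ℝ Φ x).det = (jacobian Φ x).det := by
  rw [ContinuousLinearMap.det,
    ← LinearMap.det_toMatrix (EuclideanSpace.basisFun ι ℝ).toBasis]
  rfl

/-- Since `ω(v, Jv) = ‖v‖ ^ 2`, the derivative has trivial kernel and is thus invertible. Used to
see that the image of an open shell is open. -/
theorem IsSymplecticAt.map_nhds {x : PhaseSpace n} (h : IsSymplecticAt Φ x)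
    (hΦ : ContDiff ℝ ∞ Φ) : Filter.map Φ (𝓝 x) = 𝓝 (Φ x) := by
  have hs : HasStrictFDerivAt Φ (fderiv ℝ Φ x) x :=
    hΦ.contDiffAt.hasStrictFDerivAt (by simp)
  refine hs.map_nhds_eq_of_surj ?_
  have hinj : Function.Injective (fderiv ℝ Φ x : PhaseSpace n →ₗ[ℝ] PhaseSpace n) := by
    rw [← LinearMap.ker_eq_bot, LinearMap.ker_eq_bot']
    intro v hv
    have := h v (complexStructure n v)
    rw [stdSymplecticForm_complexStructure_right, real_inner_self_eq_norm_sq] at this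
    change fderiv ℝ Φ x v = 0 at hv
    rw [hv] at this
    have h0 : ‖v‖ ^ 2 = 0 := by rw [← this]; simp [stdSymplecticForm]
    simpa using h0
  exact LinearMap.range_eq_top.2 (LinearMap.injective_iff_surjective.1 hinj)

theorem setIntegral_comp_symplectic {S : Set (PhaseSpace n)} (hS : MeasurableSet S)
    (hΦ : ContDiff ℝ ∞ Φ) (hsymp : ∀ x ∈ S, IsSymplecticAt Φ x) (hinj : InjOn Φ S)
    (f : PhaseSpace n → ℝ) : ∫ x in S, f (Φ x) = ∫ z in Φ '' S, f z := by
  rw [integral_image_eq_integral_abs_det_fderiv_smul volume hS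
    (fun x _ => (hΦ.differentiable (by simp) x).hasFDerivAt.hasFDerivWithinAt) hinj]
  refine setIntegral_congr_fun hS fun x hx => ?_
  rw [det_fderiv_eq_det_jacobian, (hsymp x hx).det_jacobian]
  simp

variable {g : PhaseSpace n → ℝ} {ρ a b a' b' : ℝ}

theorem smoothedDegree_sub (hg : IsMollifier g ρ) (hΦ : ContDiff ℝ ∞ Φ) (ha : 0 < a) (hab : a < b)
    (ha' : 0 < a') (hab' : a' < b') (p : PhaseSpace n) :
    smoothedDegree g (fun x => radialCutoff a' b' (‖x‖ ^ 2)) Φ p -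
      smoothedDegree g (fun x => radialCutoff a b (‖x‖ ^ 2)) Φ p =
    ∫ x : PhaseSpace n, (radialCutoff a' b' (‖x‖ ^ 2) - radialCutoff a b (‖x‖ ^ 2)) *
      (g (Φ x - p) * (jacobian Φ x).det) := by
  rw [smoothedDegree, smoothedDegree, ← integral_sub
    (integrable_smoothedDegree hg contDiff_radialCutoff_norm_sq
      (hasCompactSupport_radialCutoff ha' hab') hΦ p)
    (integrable_smoothedDegree hg contDiff_radialCutoff_norm_sq
      (hasCompactSupport_radialCutoff ha hab) hΦ p)]
  congr 1
  ext x
  ring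

/-- The transitions do not overlap: as `b < a'`, the inner cut-off is already `0` where the outer
one leaves `1`. -/
theorem radialCutoff_sub_mem_Icc (ha : 0 < a) (hab : a < b) (hba : b < a') (hab' : a' < b')
    (s : ℝ) : radialCutoff a' b' s - radialCutoff a b s ∈ Icc (0 : ℝ) 1 := by
  have h1 := radialCutoff_nonneg a b s
  have h2 := radialCutoff_le_one a' b' s
  refine ⟨?_, by linarith⟩
  rcases le_total s (a' ^ 2) with h | h
  · rw [radialCutoff_of_le (by linarith) hab' h]
    linarith [radialCutoff_le_one a b s]
  · have : b ^ 2 < a' ^ 2 := by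
      have : 0 < b := by linarith
      gcongr
    rw [radialCutoff_of_ge ha hab (by linarith), sub_zero]
    exact radialCutoff_nonneg _ _ _

theorem radialCutoff_sub_eq_zero (ha : 0 < a) (hab : a < b) (hba : b < a') (hab' : a' < b')
    {x : PhaseSpace n} (hx : ¬(a ≤ ‖x‖ ∧ ‖x‖ ≤ b')) :
    radialCutoff a' b' (‖x‖ ^ 2) - radialCutoff a b (‖x‖ ^ 2) = 0 := by
  have h0 := norm_nonneg x
  rw [not_and_or, not_le, not_le] at hx
  rcases hx with hx | hx
  · rw [radialCutoff_of_le ha hab (by gcongr), radialCutoff_of_le (by linarith) hab' ?_, sub_self]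
    have : ‖x‖ ≤ a' := by linarith
    gcongr
  · have : 0 ≤ b' := by linarith
    rw [radialCutoff_of_ge (by linarith) hab' (by gcongr), radialCutoff_of_ge ha hab ?_, sub_self]
    have h1 : b ≤ ‖x‖ := by linarith
    have h2 : 0 ≤ b := by linarith
    gcongr

/-- The difference of the cut-offs lives on the shell, where `Φ` is injective with determinant `1`.
The integral is thus at most that of the mollifier over the image of the shell. -/
theorem smoothedDegree_sub_mem_Icc (hg : IsMollifier g ρ) (hΦ : ContDiff ℝ ∞ Φ) (ha : 0 < a)
    (hab : a < b) (hba : b < a') (hab' : a' < b')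
    (hsymp : ∀ x, a ≤ ‖x‖ ∧ ‖x‖ ≤ b' → IsSymplecticAt Φ x)
    (hinj : InjOn Φ {x | a ≤ ‖x‖ ∧ ‖x‖ ≤ b'}) (p : PhaseSpace n) :
    smoothedDegree g (fun x => radialCutoff a' b' (‖x‖ ^ 2)) Φ p -
      smoothedDegree g (fun x => radialCutoff a b (‖x‖ ^ 2)) Φ p ∈ Icc (0 : ℝ) 1 := by
  rw [smoothedDegree_sub hg hΦ ha hab (by linarith) hab']
  let S : Set (PhaseSpace n) := {x | a ≤ ‖x‖ ∧ ‖x‖ ≤ b'}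
  have hS : MeasurableSet S := isCompact_shell.isClosed.measurableSet
  have hle : ∀ x : PhaseSpace n, 0 ≤ (radialCutoff a' b' (‖x‖ ^ 2) - radialCutoff a b (‖x‖ ^ 2)) *
      (g (Φ x - p) * (jacobian Φ x).det) ∧
      (radialCutoff a' b' (‖x‖ ^ 2) - radialCutoff a b (‖x‖ ^ 2)) *
      (g (Φ x - p) * (jacobian Φ x).det) ≤ S.indicator (fun x => g (Φ x - p)) x := by
    intro x
    have hmem := radialCutoff_sub_mem_Icc ha hab hba hab' (‖x‖ ^ 2)
    by_cases hx : x ∈ S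
    · rw [indicator_of_mem hx, (hsymp x hx).det_jacobian, mul_one]
      exact ⟨mul_nonneg hmem.1 (hg.nonneg _), mul_le_of_le_one_left (hg.nonneg _) hmem.2⟩
    · rw [indicator_of_notMem hx, radialCutoff_sub_eq_zero ha hab hba hab' hx]
      simp
  refine ⟨integral_nonneg fun x => (hle x).1, ?_⟩
  have hcont : Continuous fun x => g (Φ x - p) :=
    hg.contDiff.continuous.comp (hΦ.continuous.sub continuous_const)
  calc _ ≤ ∫ x, S.indicator (fun x => g (Φ x - p)) x :=
        integral_mono_of_nonneg (Filter.Eventually.of_forall fun x => (hle x).1)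
          ((integrable_indicator_iff hS).2
            (hcont.continuousOn.integrableOn_compact isCompact_shell))
          (Filter.Eventually.of_forall fun x => (hle x).2)
    _ = ∫ z in Φ '' S, g (z - p) := by
        rw [integral_indicator hS,
          setIntegral_comp_symplectic hS hΦ hsymp hinj (fun z => g (z - p))]
    _ ≤ ∫ z, g (z - p) := setIntegral_le_integral (hg.integrable_sub p)
        (Filter.Eventually.of_forall fun z => hg.nonneg _)
    _ = 1 := hg.integral_sub p

/-- On both collars the mollifier vanishes, so the weight is effectively the indicator of the open
shell between them. The ball of radius `ρ` about `p` meets no image of its boundary spheres, hence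
by connectedness lies inside the image of that shell or misses it. -/
theorem smoothedDegree_sub_eq_zero_or_one (hg : IsMollifier g ρ) (hΦ : ContDiff ℝ ∞ Φ)
    (ha : 0 < a) (hab : a < b) (hba : b < a') (hab' : a' < b')
    (hsymp : ∀ x, a ≤ ‖x‖ ∧ ‖x‖ ≤ b' → IsSymplecticAt Φ x)
    (hinj : InjOn Φ {x | a ≤ ‖x‖ ∧ ‖x‖ ≤ b'}) {p : PhaseSpace n}
    (hp : ∀ x, a ≤ ‖x‖ ∧ ‖x‖ ≤ b → ρ ≤ ‖Φ x - p‖)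
    (hp' : ∀ x, a' ≤ ‖x‖ ∧ ‖x‖ ≤ b' → ρ ≤ ‖Φ x - p‖) :
    smoothedDegree g (fun x => radialCutoff a' b' (‖x‖ ^ 2)) Φ p -
      smoothedDegree g (fun x => radialCutoff a b (‖x‖ ^ 2)) Φ p = 0 ∨
    smoothedDegree g (fun x => radialCutoff a' b' (‖x‖ ^ 2)) Φ p -
      smoothedDegree g (fun x => radialCutoff a b (‖x‖ ^ 2)) Φ p = 1 := by
  rw [smoothedDegree_sub hg hΦ ha hab (by linarith) hab']
  let m : Set (PhaseSpace n) := {x | b < ‖x‖ ∧ ‖x‖ < a'}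
  have hmo : IsOpen m := (isOpen_lt continuous_const continuous_norm).inter
    (isOpen_lt continuous_norm continuous_const)
  have hmS : m ⊆ {x | a ≤ ‖x‖ ∧ ‖x‖ ≤ b'} := fun x hx =>
    ⟨by linarith [hx.1], by linarith [hx.2]⟩
  have heq : ∀ x : PhaseSpace n,
      (radialCutoff a' b' (‖x‖ ^ 2) - radialCutoff a b (‖x‖ ^ 2)) *
      (g (Φ x - p) * (jacobian Φ x).det) = m.indicator (fun x => g (Φ x - p)) x := by
    intro x
    by_cases hx : x ∈ m
    · have hb : 0 ≤ b := by linarith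
      rw [indicator_of_mem hx, (hsymp x (hmS hx)).det_jacobian,
        radialCutoff_of_le (by linarith) hab' (by have := hx.2; gcongr),
        radialCutoff_of_ge ha hab (by have := hx.1; gcongr)]
      ring
    · rw [indicator_of_notMem hx]
      by_cases h1 : a ≤ ‖x‖ ∧ ‖x‖ ≤ b
      · rw [hg.eq_zero _ (hp x h1)]; ring
      by_cases h2 : a' ≤ ‖x‖ ∧ ‖x‖ ≤ b'
      · rw [hg.eq_zero _ (hp' x h2)]; ring
      rw [radialCutoff_sub_eq_zero ha hab hba hab', zero_mul]
      rintro ⟨h3, h4⟩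
      refine hx ⟨?_, ?_⟩
      · by_contra! h; exact h1 ⟨h3, h⟩
      · by_contra! h; exact h2 ⟨h, h4⟩
  rw [integral_congr_ae (Filter.Eventually.of_forall heq), integral_indicator hmo.measurableSet,
    setIntegral_comp_symplectic hmo.measurableSet hΦ (fun x hx => hsymp x (hmS hx))
      (hinj.mono hmS) (fun z => g (z - p))]
  have hopen : IsOpen (Φ '' m) := by
    rw [isOpen_iff_mem_nhds]
    rintro _ ⟨x, hx, rfl⟩
    rw [← (hsymp x (hmS hx)).map_nhds hΦ]
    exact Filter.image_mem_map (hmo.mem_nhds hx)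
  let m' : Set (PhaseSpace n) := {x | b ≤ ‖x‖ ∧ ‖x‖ ≤ a'}
  have hclosed : IsClosed (Φ '' m') := (isCompact_shell.image hΦ.continuous).isClosed
  have hmm' : m ⊆ m' := fun x hx => ⟨hx.1.le, hx.2.le⟩
  have hcover : ball p ρ ⊆ Φ '' m ∪ (Φ '' m')ᶜ := by
    intro z hz
    by_contra hcon
    rw [mem_union, not_or, notMem_compl_iff] at hcon
    obtain ⟨h1, ⟨x, hx, rfl⟩⟩ := hcon
    rw [mem_ball, dist_eq_norm] at hz
    have hxm : x ∉ m := fun h => h1 ⟨x, h, rfl⟩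
    rcases hx.1.eq_or_lt with h | h
    · exact absurd (hp x ⟨by linarith, h.ge⟩) (by linarith)
    · rcases hx.2.eq_or_lt with h' | h'
      · exact absurd (hp' x ⟨h'.ge, by linarith⟩) (by linarith)
      · exact hxm ⟨h, h'⟩
  have hout : ∀ z, z ∉ ball p ρ → g (z - p) = 0 := fun z hz =>
    hg.eq_zero _ (by simpa [dist_eq_norm] using hz)
  have hdisj : Disjoint (Φ '' m) (Φ '' m')ᶜ :=
    disjoint_compl_right_iff_subset.2 (image_mono hmm')
  rcases isPreconnected_iff_subset_of_disjoint.1 (convex_ball p ρ).isPreconnected _ _ hopen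
    hclosed.isOpen_compl hcover (by rw [hdisj.inter_eq, inter_empty]) with h | h
  · right
    rw [setIntegral_eq_integral_of_forall_compl_eq_zero fun z hz => hout z fun hz' => hz (h hz'),
      hg.integral_sub]
  · left
    refine setIntegral_eq_zero_of_forall_eq_zero fun z hz => hout z fun hz' => ?_
    exact h hz' (image_mono hmm' hz)

/-- A function whose derivative vanishes along a segment takes the same value at its endpoints. -/
theorem eq_of_fderiv_eq_zero_on_segment {E : Type*} [NormedAddCommGroup E] [NormedSpace ℝ E]
    {f : E → ℝ} (hf : Differentiable ℝ f) {p q : E} (h : ∀ z ∈ segment ℝ p q, fderiv ℝ f z = 0) :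
    f p = f q := by
  have := (convex_segment p q).norm_image_sub_le_of_norm_fderiv_le (𝕜 := ℝ) (f := f) (C := 0)
    (fun z _ => hf z) (fun z hz => by simp [h z hz]) (right_mem_segment ℝ p q)
    (left_mem_segment ℝ p q)
  simpa [sub_eq_zero] using this

theorem integral_smoothedDegree_radialCutoff (hn : 2 ≤ n) (hg : IsMollifier g ρ)
    (hΦ : ContDiff ℝ ∞ Φ) (ha : 0 < a) (hab : a < b)
    (hsymp : ∀ x, a ≤ ‖x‖ ∧ ‖x‖ ≤ b → IsSymplecticAt Φ x) {R : ℝ} (hR : ∀ x, ‖Φ x‖ ≤ R) :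
    ∫ p, smoothedDegree g (fun x => radialCutoff a b (‖x‖ ^ 2)) Φ p =
      ∫ x : PhaseSpace n, radialCutoff a b (‖x‖ ^ 2) := by
  rw [integral_smoothedDegree hg contDiff_radialCutoff_norm_sq
    (hasCompactSupport_radialCutoff ha hab) hΦ hR]
  exact integral_radial_mul_det_jacobian hn hΦ (contDiff_radialCutoff a b) (R := b ^ 2)
    (fun s hs => radialCutoff_of_ge ha hab hs.le)
    fun x hx => hsymp x (deriv_radialCutoff_norm_sq ha hab hx)

/-- A symplectic embedding of a shell winds exactly once around some points and not at all around
the others: the smoothed degree of its outermost sphere has values in `[0, 1]`, and in `{0, 1}` away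
from the image of that sphere. -/
theorem smoothedDegree_mem_Icc_and_eq (hn : 2 ≤ n) (hg : IsMollifier g ρ) (hρ : 0 < ρ)
    (hΦ : ContDiff ℝ ∞ Φ) (ha : 0 < a) (hab : a < b) (hba : b < a') (hab' : a' < b')
    (hsymp : ∀ x, a ≤ ‖x‖ ∧ ‖x‖ ≤ b' → IsSymplecticAt Φ x)
    (hinj : InjOn Φ {x | a ≤ ‖x‖ ∧ ‖x‖ ≤ b'})
    (hsep : ∀ x y, a ≤ ‖x‖ ∧ ‖x‖ ≤ b → a' ≤ ‖y‖ ∧ ‖y‖ ≤ b' → 3 * ρ ≤ ‖Φ x - Φ y‖)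
    {R : ℝ} (hR : ∀ x, ‖Φ x‖ ≤ R) :
    (∀ p, smoothedDegree g (fun x => radialCutoff a b (‖x‖ ^ 2)) Φ p ∈ Icc (0 : ℝ) 1) ∧
    ∀ p, (∀ x, a ≤ ‖x‖ ∧ ‖x‖ ≤ b → ρ ≤ ‖Φ x - p‖) →
      smoothedDegree g (fun x => radialCutoff a b (‖x‖ ^ 2)) Φ p = 0 ∨
      smoothedDegree g (fun x => radialCutoff a b (‖x‖ ^ 2)) Φ p = 1 := by
  set W := smoothedDegree g (fun x => radialCutoff a b (‖x‖ ^ 2)) Φ with hW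
  set W' := smoothedDegree g (fun x => radialCutoff a' b' (‖x‖ ^ 2)) Φ with hW'
  have ha' : 0 < a' := by linarith
  have hχ := contDiff_radialCutoff_norm_sq (a := a) (b := b) (E := PhaseSpace n)
  have hχ' := contDiff_radialCutoff_norm_sq (a := a') (b := b') (E := PhaseSpace n)
  have hc := hasCompactSupport_radialCutoff (E := PhaseSpace n) ha hab
  have hc' := hasCompactSupport_radialCutoff (E := PhaseSpace n) ha' hab'
  have hWd : Differentiable ℝ W := fun p =>
    (hasFDerivAt_smoothedDegree hg hχ hc hΦ p).differentiableAt
  have hWd' : Differentiable ℝ W' := fun p =>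
    (hasFDerivAt_smoothedDegree hg hχ' hc' hΦ p).differentiableAt
  have hrank : 1 < Module.rank ℝ (PhaseSpace n) := by
    rw [← Module.finrank_eq_rank, finrank_euclideanSpace]
    simp only [Fintype.card_sum, Fintype.card_fin]
    exact_mod_cast (by omega : 1 < n + n)
  let S : Set (PhaseSpace n) := {x | a ≤ ‖x‖ ∧ ‖x‖ ≤ b}
  let K := Φ '' S
  have hK : IsCompact K := isCompact_shell.image hΦ.continuous
  have : Nontrivial (PhaseSpace n) := by
    have : Nonempty (Fin n) := ⟨⟨0, by omega⟩⟩
    infer_instance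
  obtain ⟨x₀, hx₀⟩ := exists_norm_eq (PhaseSpace n) ha.le
  have hKne : K.Nonempty := ⟨Φ x₀, x₀, ⟨hx₀.ge, by linarith⟩, rfl⟩
  have hKc : IsPreconnected K := (isPreconnected_shell hrank ha).image _ hΦ.continuous.continuousOn
  -- The outer collar has image at distance at least `3ρ` from `K`, hence at least `ρ` from `T`: so
  -- `W'` is a constant `c` on the connected set `T`. There `W` inherits the values `[c - 1, c]`
  -- from the difference `W' - W`.
  let T := thickening (2 * ρ) K
  have hTc : IsPreconnected T := by
    have : T = (fun z : PhaseSpace n × PhaseSpace n => z.1 + z.2) '' (K ×ˢ ball 0 (2 * ρ)) := by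
      rw [show T = K + ball 0 (2 * ρ) by rw [add_ball_zero]]
      exact add_image_prod.symm
    rw [this]
    exact (hKc.prod (convex_ball _ _).isPreconnected).image _ continuous_add.continuousOn
  have hfar' : ∀ p ∈ T, ∀ x, a' ≤ ‖x‖ ∧ ‖x‖ ≤ b' → ρ ≤ ‖Φ x - p‖ := by
    intro p hp x hx
    obtain ⟨_, ⟨y, hy, rfl⟩, hd⟩ := mem_thickening_iff.1 hp
    have h1 := hsep y x hy hx
    have h2 := norm_sub_le_norm_sub_add_norm_sub (Φ y) p (Φ x)
    rw [dist_eq_norm, norm_sub_rev] at hd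
    rw [norm_sub_rev p] at h2
    linarith
  have hW'c : ∀ p ∈ T, ∀ q ∈ T, W' p = W' q := fun p hp q hq =>
    isOpen_thickening.is_const_of_fderiv_eq_zero hTc hWd'.differentiableOn
      (fun z hz => fderiv_smoothedDegree_eq_zero hg hχ' hc' hΦ fun x hx =>
        hfar' z hz x (fderiv_radialCutoff_norm_sq ha' hab' hx)) hp hq
  obtain ⟨y₀, hy₀⟩ := hKne
  have hy₀T : y₀ ∈ T := self_subset_thickening (by linarith) _ hy₀
  set c := W' y₀ with hc_def
  have hT : ∀ p ∈ T, W p ∈ Icc (c - 1) c := by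
    intro p hp
    have := smoothedDegree_sub_mem_Icc hg hΦ ha hab hba hab' hsymp hinj p
    rw [← hW, ← hW', hW'c p hp y₀ hy₀T, mem_Icc] at this
    exact ⟨by linarith [this.2], by linarith [this.1]⟩
  have hT' : ∀ p ∈ T, (∀ x, a ≤ ‖x‖ ∧ ‖x‖ ≤ b → ρ ≤ ‖Φ x - p‖) → W p = c ∨ W p = c - 1 := by
    intro p hp hpx
    have := smoothedDegree_sub_eq_zero_or_one hg hΦ ha hab hba hab' hsymp hinj hpx (hfar' p hp)
    rw [← hW, ← hW', hW'c p hp y₀ hy₀T] at this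
    exact this.imp (fun h => by linarith) (fun h => by linarith)
  -- Away from `T`, slide `p` towards its nearest point of `K` until the distance is `ρ`. The path
  -- stays at distance at least `ρ` from `K`, so `W` does not change, and it ends in `T`.
  have hmiss : ∀ p, (∀ x, a ≤ ‖x‖ ∧ ‖x‖ ≤ b → ρ ≤ ‖Φ x - p‖) → W p = c ∨ W p = c - 1 := by
    intro p hp
    obtain ⟨y, hyK, hy⟩ := hK.exists_infDist_eq_dist ⟨y₀, hy₀⟩ p
    obtain ⟨x₁, hx₁, rfl⟩ := hyK
    have hle : ρ ≤ ‖p - Φ x₁‖ := by rw [norm_sub_rev]; exact hp x₁ hx₁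
    have hpos : 0 < ‖p - Φ x₁‖ := by linarith
    let q := Φ x₁ + (ρ / ‖p - Φ x₁‖) • (p - Φ x₁)
    have hqn : ‖q - Φ x₁‖ = ρ := by
      simp only [q, add_sub_cancel_left, norm_smul, Real.norm_eq_abs,
        abs_of_pos (div_pos hρ hpos)]
      field_simp
    have hseg : ∀ z ∈ segment ℝ p q, ∀ x, a ≤ ‖x‖ ∧ ‖x‖ ≤ b → ρ ≤ ‖Φ x - z‖ := by
      intro z hz x hx
      rw [segment_eq_image'] at hz
      obtain ⟨t, ⟨ht0, ht1⟩, rfl⟩ := hz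
      have h1 : infDist p K ≤ dist p (Φ x) := infDist_le_dist_of_mem ⟨x, hx, rfl⟩
      rw [hy, dist_eq_norm, dist_eq_norm] at h1
      have h2 : q - p = -((1 - ρ / ‖p - Φ x₁‖) • (p - Φ x₁)) := by
        simp only [q]; module
      have h3 : ρ / ‖p - Φ x₁‖ ≤ 1 := (div_le_one hpos).2 hle
      have h4 : ‖t • (q - p)‖ ≤ ‖p - Φ x₁‖ - ρ := by
        rw [norm_smul, Real.norm_eq_abs, abs_of_nonneg ht0, h2, norm_neg, norm_smul,
          Real.norm_eq_abs, abs_of_nonneg (by linarith)]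
        have h5 : (1 - ρ / ‖p - Φ x₁‖) * ‖p - Φ x₁‖ = ‖p - Φ x₁‖ - ρ := by field_simp
        rw [h5]
        exact mul_le_of_le_one_left (by linarith) ht1
      have h6 : ‖p - Φ x‖ ≤ ‖Φ x - (p + t • (q - p))‖ + ‖t • (q - p)‖ := by
        have := norm_add_le (Φ x - (p + t • (q - p))) (t • (q - p))
        rw [show Φ x - (p + t • (q - p)) + t • (q - p) = Φ x - p by abel, norm_sub_rev] at this
        exact this
      linarith
    have hpq : W p = W q := eq_of_fderiv_eq_zero_on_segment hWd fun z hz =>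
      fderiv_smoothedDegree_eq_zero hg hχ hc hΦ fun x hx =>
        hseg z hz x (fderiv_radialCutoff_norm_sq ha hab hx)
    rw [hpq]
    refine hT' q ?_ (hseg q (right_mem_segment ℝ p q))
    exact mem_thickening_iff.2 ⟨Φ x₁, ⟨x₁, hx₁, rfl⟩, by rw [dist_eq_norm, hqn]; linarith⟩
  have hall : ∀ p, W p ∈ Icc (c - 1) c := by
    intro p
    by_cases hp : p ∈ T
    · exact hT p hp
    · have : W p = c ∨ W p = c - 1 := hmiss p fun x hx => by
        by_contra! h
        refine hp (mem_thickening_iff.2 ⟨Φ x, ⟨x, hx, rfl⟩, ?_⟩)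
        rw [dist_eq_norm, norm_sub_rev]
        linarith
      rcases this with h | h <;> rw [h] <;> constructor <;> linarith
  -- Far outside the image of `Φ` the degree is `0`, so one of `c` and `c - 1` is `0`.
  have hc01 : c = 0 ∨ c = 1 := by
    obtain ⟨q, hq⟩ := exists_norm_eq (PhaseSpace n)
      (show 0 ≤ |R| + ρ by have := abs_nonneg R; linarith)
    have hRq : ∀ x, ρ ≤ ‖Φ x - q‖ := fun x => by
      have := norm_sub_norm_le q (Φ x)
      rw [norm_sub_rev] at this
      linarith [hR x, le_abs_self R]
    have h0 : W q = 0 := smoothedDegree_eq_zero hg hR (by linarith [le_abs_self R])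
    rcases hmiss q fun x _ => hRq x with h | h
    · left; linarith
    · right; linarith
  have hint : ∫ p, W p = ∫ x : PhaseSpace n, radialCutoff a b (‖x‖ ^ 2) :=
    integral_smoothedDegree_radialCutoff hn hg hΦ ha hab
      (fun x hx => hsymp x ⟨hx.1, by linarith [hx.2]⟩) hR
  have hpos : 0 < ∫ x : PhaseSpace n, radialCutoff a b (‖x‖ ^ 2) := by
    refine lt_of_lt_of_le ?_ (volume_closedBall_le_integral_radialCutoff ha hab)
    exact ENNReal.toReal_pos (measure_closedBall_pos volume _ ha).ne' measure_closedBall_lt_top.ne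
  have hc1 : c = 1 := by
    -- If `c = 0` then `W ≤ 0` everywhere, against the positive volume it integrates to.
    refine hc01.resolve_left fun h0 => ?_
    rw [← hint] at hpos
    exact absurd hpos (not_lt.2 (integral_nonpos fun p => by
      have := (hall p).2
      simpa [h0] using this))
  rw [hc1] at hall hmiss
  refine ⟨fun p => by simpa using hall p, fun p hp => ?_⟩
  simpa [or_comm] using hmiss p hp

end Shell

/-! ### From an embedding to bounds on its radius. -/

section ShellEmbedding

variable {n : ℕ} {r δ ε : ℝ}

theorem smul_closedShell (hr : 0 < r) :
    r • closedShell n δ = {x | r * (1 - δ) ≤ ‖x‖ ∧ ‖x‖ ≤ r} := by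
  ext x
  rw [mem_smul_set_iff_inv_smul_mem₀ hr.ne']
  simp only [closedShell, mem_sdiff, mem_closedBall_zero_iff, mem_ball_zero_iff, not_lt, norm_smul,
    norm_inv, Real.norm_eq_abs, abs_of_pos hr, mem_ofPred_eq]
  rw [inv_mul_le_iff₀ hr, le_inv_mul_iff₀ hr, mul_one, and_comm]

theorem mem_openShell {x : PhaseSpace n} : x ∈ openShell n ε ↔ 1 - ε < ‖x‖ ∧ ‖x‖ < 1 := by
  simp [openShell, and_comm]

/-- A point whose norm is within `η` of the interval `[a, b]` is within `η` of the shell with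
radii `a` and `b`. -/
theorem mem_cthickening_shell {E : Type*} [NormedAddCommGroup E] [NormedSpace ℝ E] {a b η : ℝ}
    (ha : 0 < a) (hab : a ≤ b) {x : E} (hx : 0 < ‖x‖) (h1 : a - η ≤ ‖x‖)
    (h2 : ‖x‖ ≤ b + η) (hη : 0 ≤ η) : x ∈ cthickening η {y : E | a ≤ ‖y‖ ∧ ‖y‖ ≤ b} := by
  -- The norm clamped to `[a, b]`; the nearby point of the shell is `x` rescaled to norm `t`.
  let t := max a (min b ‖x‖)
  have ht : 0 < t := lt_max_of_lt_left ha
  have hta : a ≤ t := le_max_left _ _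
  have htb : t ≤ b := max_le hab (min_le_left _ _)
  have hd : |‖x‖ - t| ≤ η := by
    rw [abs_le]
    simp only [t]
    rcases max_cases a (min b ‖x‖) with h | h <;> rcases min_cases b ‖x‖ with h' | h' <;>
      constructor <;> linarith
  refine mem_cthickening_of_dist_le x ((t / ‖x‖) • x) η _ ?_ ?_
  · simp only [mem_ofPred_eq, norm_smul, norm_div, Real.norm_eq_abs, abs_of_pos ht, abs_norm]
    rw [div_mul_cancel₀ _ hx.ne']
    exact ⟨hta, htb⟩
  · have : x - (t / ‖x‖) • x = ((‖x‖ - t) / ‖x‖) • x := by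
      rw [sub_div, div_self hx.ne', sub_smul, one_smul]
    rw [dist_eq_norm, this, norm_smul, norm_div, norm_norm, div_mul_cancel₀ _ hx.ne',
      Real.norm_eq_abs]
    exact hd

/-- A symplectic embedding of a closed shell into a subset of the unit ball coincides, near a
slightly larger shell, with a smooth map of the whole space into a smaller ball. -/
theorem SymplecticallyEmbeds.exists_extension {V : Set (PhaseSpace n)}
    (h : SymplecticallyEmbeds (r • closedShell n δ) V) (hV : V ⊆ ball 0 1) (hr : 0 < r)
    (hδ : δ ∈ Ioo (0 : ℝ) 1) :
    ∃ (Φ : PhaseSpace n → PhaseSpace n) (η R : ℝ), 0 < η ∧ η < r * (1 - δ) ∧ R < 1 ∧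
      ContDiff ℝ ∞ Φ ∧ (∀ x, ‖Φ x‖ ≤ R) ∧
      InjOn Φ {x | r * (1 - δ) - η ≤ ‖x‖ ∧ ‖x‖ ≤ r + 3 * η} ∧
      ∀ x, r * (1 - δ) - η ≤ ‖x‖ ∧ ‖x‖ ≤ r + 3 * η → IsSymplecticAt Φ x ∧ Φ x ∈ V := by
  obtain ⟨O, φ, hAO, hφ⟩ := h
  rw [smul_closedShell hr] at hAO
  have hrδ : 0 < r * (1 - δ) := mul_pos hr (by linarith [hδ.2])
  have hrr : r * (1 - δ) ≤ r := by nlinarith [hδ.1]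
  obtain ⟨d, hd, hdO⟩ := isCompact_shell.exists_cthickening_subset_open hφ.isOpen_source hAO
  -- Room for three nested shells: `φ` is defined on radii `[s - 3η, r + 5η]`, the cut-off `ψ` is
  -- `1` on `[s - 2η, r + 4η]`, and the conclusions concern `[s - η, r + 3η]`, on a neighbourhood of
  -- which `Φ = φ`.
  obtain ⟨η, hη, hη1, hη2⟩ : ∃ η, 0 < η ∧ 5 * η ≤ d ∧ 3 * η < r * (1 - δ) :=
    ⟨min (d / 5) (r * (1 - δ) / 4), by positivity,
      by linarith [min_le_left (d / 5) (r * (1 - δ) / 4)],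
      by linarith [min_le_right (d / 5) (r * (1 - δ) / 4)]⟩
  set s := r * (1 - δ) with hs
  let S : Set (PhaseSpace n) := {x | s - 3 * η ≤ ‖x‖ ∧ ‖x‖ ≤ r + 5 * η}
  have hSO : S ⊆ O := fun x hx => hdO <| mem_cthickening_shell hrδ hrr
    (by linarith [hx.1]) (by linarith [hx.1]) (by linarith [hx.2]) hd.le
  have hSc : IsCompact S := isCompact_shell
  let ψ : PhaseSpace n → ℝ := fun x => radialCutoff (r + 4 * η) (r + 5 * η) (‖x‖ ^ 2) *
    (1 - radialCutoff (s - 3 * η) (s - 2 * η) (‖x‖ ^ 2))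
  have hψ : ContDiff ℝ ∞ ψ :=
    contDiff_radialCutoff_norm_sq.mul (contDiff_const.sub contDiff_radialCutoff_norm_sq)
  have hψ0 : ∀ x, x ∉ S → ψ x = 0 := by
    intro x hx
    have h0 := norm_nonneg x
    rcases not_and_or.1 hx with hx | hx <;> rw [not_le] at hx
    · simp only [ψ]
      rw [radialCutoff_of_le (a := s - 3 * η) (by linarith) (by linarith) (by gcongr), sub_self,
        mul_zero]
    · simp only [ψ]
      rw [radialCutoff_of_ge (b := r + 5 * η) (by linarith) (by linarith) (by gcongr), zero_mul]
  have hψ1 : ∀ x, s - 2 * η ≤ ‖x‖ → ‖x‖ ≤ r + 4 * η → ψ x = 1 := by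
    intro x h1 h2
    have h3 : 0 ≤ s - 2 * η := by linarith
    simp only [ψ]
    rw [radialCutoff_of_ge (b := s - 2 * η) (by linarith) (by linarith) (by gcongr),
      radialCutoff_of_le (a := r + 4 * η) (by linarith) (by linarith) (by gcongr)]
    norm_num
  have hψI : ∀ x, 0 ≤ ψ x ∧ ψ x ≤ 1 := by
    intro x
    have h1 := radialCutoff_nonneg (s - 3 * η) (s - 2 * η) (‖x‖ ^ 2)
    have h2 := radialCutoff_le_one (s - 3 * η) (s - 2 * η) (‖x‖ ^ 2)
    have h3 := radialCutoff_nonneg (r + 4 * η) (r + 5 * η) (‖x‖ ^ 2)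
    have h4 := radialCutoff_le_one (r + 4 * η) (r + 5 * η) (‖x‖ ^ 2)
    exact ⟨mul_nonneg h3 (by linarith), mul_le_one₀ h4 (by linarith) (by linarith)⟩
  let Φ : PhaseSpace n → PhaseSpace n := fun x => ψ x • φ x
  have hΦ0 : ∀ x, x ∉ S → Φ x = 0 := fun x hx => by simp [Φ, hψ0 x hx]
  have hΦ : ContDiff ℝ ∞ Φ := by
    rw [contDiff_iff_contDiffAt]
    intro x
    by_cases hx : x ∈ O
    · exact hψ.contDiffAt.smul (hφ.contDiffOn.contDiffAt (hφ.isOpen_source.mem_nhds hx))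
    · have : Φ =ᶠ[𝓝 x] fun _ => 0 := by
        filter_upwards [hSc.isClosed.isOpen_compl.mem_nhds fun h => hx (hSO h)] with y hy
        exact hΦ0 y hy
      exact contDiffAt_const.congr_of_eventuallyEq this
  have hΦc : HasCompactSupport Φ := HasCompactSupport.intro hSc hΦ0
  -- Scaling towards `0` keeps `Φ` in the unit ball; by compact support the norm attains its
  -- maximum, which is the radius `R < 1`.
  have hlt : ∀ x, ‖Φ x‖ < 1 := by
    intro x
    by_cases hx : x ∈ S
    · have h1 : ‖φ x‖ < 1 := by simpa using hV (hφ.mapsTo (hSO hx))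
      rw [norm_smul, Real.norm_eq_abs, abs_of_nonneg (hψI x).1]
      exact (mul_le_of_le_one_left (norm_nonneg _) (hψI x).2).trans_lt h1
    · simp [hΦ0 x hx]
  obtain ⟨_, ⟨x₀, rfl⟩, hmax⟩ := (hΦc.isCompact_range hΦ.continuous).exists_isMaxOn
    (range_nonempty Φ) continuous_norm.continuousOn
  have hΦφ : ∀ x, s - 2 * η ≤ ‖x‖ → ‖x‖ ≤ r + 4 * η → Φ x = φ x := fun x h1 h2 => by
    simp [Φ, hψ1 x h1 h2]
  refine ⟨Φ, η, ‖Φ x₀‖, hη, by linarith, hlt x₀, hΦ, fun x => hmax ⟨x, rfl⟩, ?_, ?_⟩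
  · intro x hx y hy hxy
    rw [hΦφ x (by linarith [hx.1]) (by linarith [hx.2]),
      hΦφ y (by linarith [hy.1]) (by linarith [hy.2])] at hxy
    have hxO : x ∈ O := hSO ⟨by linarith [hx.1], by linarith [hx.2]⟩
    have hyO : y ∈ O := hSO ⟨by linarith [hy.1], by linarith [hy.2]⟩
    have := @hφ.isEmbedding.injective ⟨x, hxO⟩ ⟨y, hyO⟩ hxy
    exact congrArg Subtype.val this
  · intro x hx
    have hxO : x ∈ O := hSO ⟨by linarith [hx.1], by linarith [hx.2]⟩
    refine ⟨?_, ?_⟩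
    · have : Φ =ᶠ[𝓝 x] φ := by
        filter_upwards [(isOpen_lt continuous_const continuous_norm).mem_nhds
            (show s - 2 * η < ‖x‖ by linarith [hx.1]),
          (isOpen_lt continuous_norm continuous_const).mem_nhds
            (show ‖x‖ < r + 4 * η by linarith [hx.2])] with y h1 h2
        exact hΦφ y (le_of_lt h1) (le_of_lt h2)
      intro v w
      rw [this.fderiv_eq]
      exact hφ.pullback_eq x hxO v w
    · rw [hΦφ x (by linarith [hx.1]) (by linarith [hx.2])]
      exact hφ.mapsTo hxO

theorem volume_real_closedBall (s : ℝ) (hs : 0 ≤ s) :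
    volume.real (closedBall (0 : PhaseSpace n) s) =
      s ^ (2 * n) * volume.real (ball (0 : PhaseSpace n) 1) := by
  rw [Measure.addHaar_real_closedBall _ _ hs, finrank_euclideanSpace]
  simp [two_mul]

theorem volume_real_ball_pos : 0 < volume.real (ball (0 : PhaseSpace n) 1) :=
  ENNReal.toReal_pos (measure_ball_pos volume _ one_pos).ne' measure_ball_lt_top.ne

/-- Disjoint shells have disjoint, hence separated, images under an injective continuous map. -/
theorem exists_separation {Φ : PhaseSpace n → PhaseSpace n} (hΦ : Continuous Φ) {a b a' b' : ℝ}
    {S : Set (PhaseSpace n)} (hinj : InjOn Φ S) (hba : b < a')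
    (h1 : {x : PhaseSpace n | a ≤ ‖x‖ ∧ ‖x‖ ≤ b} ⊆ S)
    (h2 : {x : PhaseSpace n | a' ≤ ‖x‖ ∧ ‖x‖ ≤ b'} ⊆ S) :
    ∃ d, 0 < d ∧ ∀ x y, a ≤ ‖x‖ ∧ ‖x‖ ≤ b → a' ≤ ‖y‖ ∧ ‖y‖ ≤ b' → d ≤ ‖Φ x - Φ y‖ := by
  obtain ⟨d, hd, h⟩ := (isCompact_shell.prod isCompact_shell :
      IsCompact ({x : PhaseSpace n | a ≤ ‖x‖ ∧ ‖x‖ ≤ b} ×ˢ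
        {x : PhaseSpace n | a' ≤ ‖x‖ ∧ ‖x‖ ≤ b'})).exists_forall_le' (a := (0 : ℝ))
    (f := fun p : PhaseSpace n × PhaseSpace n => ‖Φ p.1 - Φ p.2‖)
    (by fun_prop) (by
      rintro ⟨x, y⟩ ⟨hx, hy⟩
      rw [norm_sub_pos_iff]
      intro hxy
      have := hinj (h1 hx) (h2 hy) hxy
      simp only at this hx hy
      subst this
      linarith [hx.2, hy.1])
  exact ⟨d, hd, fun x y hx hy => h (x, y) ⟨hx, hy⟩⟩

/-- Volume obstructions to embedding a closed shell symplectically into an open one. -/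
theorem SymplecticallyEmbeds.radius_bounds (hn : 2 ≤ n) (hr : 0 < r) (hδ : δ ∈ Ioo (0 : ℝ) 1)
    (hε : ε ∈ Ioo (0 : ℝ) 1) (h : SymplecticallyEmbeds (r • closedShell n δ) (openShell n ε)) :
    r < 1 ∧ (ε ≤ δ → r ^ (2 * n) ≤ 1 - (1 - ε) ^ (2 * n)) := by
  obtain ⟨Φ, η, R, hη, hηr, hR1, hΦ, hR, hinj, hsV⟩ :=
    h.exists_extension (fun x hx => hx.1) hr hδ
  have hsymp := fun x hx => (hsV x hx).1
  set s := r * (1 - δ) with hs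
  have hsr : s < r := by nlinarith [hδ.1]
  -- The outer collar is `[r, r + η]` and the inner one `[s - η, s]`. Both are compared with the
  -- auxiliary collar `[r + 2η, r + 3η]`.
  obtain ⟨d₁, hd₁, hsep₁⟩ := exists_separation (a := r) (b := r + η) (a' := r + 2 * η)
    (b' := r + 3 * η) hΦ.continuous hinj (by linarith)
    (fun x hx => ⟨by linarith [hx.1], by linarith [hx.2]⟩)
    (fun x hx => ⟨by linarith [hx.1], by linarith [hx.2]⟩)
  obtain ⟨d₂, hd₂, hsep₂⟩ := exists_separation (a := s - η) (b := s) (a' := r + 2 * η)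
    (b' := r + 3 * η) hΦ.continuous hinj (by linarith)
    (fun x hx => ⟨by linarith [hx.1], by linarith [hx.2]⟩)
    (fun x hx => ⟨by linarith [hx.1], by linarith [hx.2]⟩)
  obtain ⟨d₃, hd₃, hgap⟩ := (isCompact_shell : IsCompact
      {x : PhaseSpace n | s - η ≤ ‖x‖ ∧ ‖x‖ ≤ r + 3 * η}).exists_forall_le'
    (hΦ.continuous.norm.continuousOn) (a := 1 - ε) fun x hx => (mem_openShell.1 (hsV x hx).2).1
  -- `ρ` must respect both separations, keep the missed ball at distance `ρ` from the image of the
  -- shell, and confine the smoothed degrees to the unit ball.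
  obtain ⟨ρ, hρ, hρ1, hρ2, hρ3, hρ4⟩ : ∃ ρ, 0 < ρ ∧ 3 * ρ ≤ d₁ ∧ 3 * ρ ≤ d₂ ∧
      ρ ≤ d₃ - (1 - ε) ∧ R + ρ < 1 := by
    have hm : 0 < min (min (d₁ / 3) (d₂ / 3)) (min (d₃ - (1 - ε)) ((1 - R) / 2)) :=
      lt_min (lt_min (by positivity) (by positivity)) (lt_min (by linarith) (by linarith))
    have l1 := min_le_left (min (d₁ / 3) (d₂ / 3)) (min (d₃ - (1 - ε)) ((1 - R) / 2))
    have l2 := min_le_right (min (d₁ / 3) (d₂ / 3)) (min (d₃ - (1 - ε)) ((1 - R) / 2))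
    refine ⟨_, hm, ?_, ?_, l2.trans (min_le_left _ _), ?_⟩
    · linarith [min_le_left (d₁ / 3) (d₂ / 3)]
    · linarith [min_le_right (d₁ / 3) (d₂ / 3)]
    · linarith [min_le_right (d₃ - (1 - ε)) ((1 - R) / 2)]
  obtain ⟨g, hg⟩ := exists_isMollifier (ι := Fin n ⊕ Fin n) hρ
  have hR0 : 0 ≤ R := (norm_nonneg _).trans (hR 0)
  set Wo := smoothedDegree g (fun x => radialCutoff r (r + η) (‖x‖ ^ 2)) Φ with hWo
  set Wi := smoothedDegree g (fun x => radialCutoff (s - η) s (‖x‖ ^ 2)) Φ with hWi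
  obtain ⟨hWoI, hWo01⟩ := smoothedDegree_mem_Icc_and_eq (a := r) (b := r + η) (a' := r + 2 * η)
    (b' := r + 3 * η) hn hg hρ hΦ hr (by linarith) (by linarith) (by linarith)
    (fun x hx => hsymp x ⟨by linarith [hx.1], by linarith [hx.2]⟩)
    (hinj.mono (by rintro x ⟨h1, h2⟩; exact ⟨by linarith, by linarith⟩))
    (fun x y hx hy => hρ1.trans (hsep₁ x y hx hy)) hR
  obtain ⟨hWiI, -⟩ := smoothedDegree_mem_Icc_and_eq (a := s - η) (b := s) (a' := r + 2 * η)
    (b' := r + 3 * η) hn hg hρ hΦ (by linarith) (by linarith) (by linarith) (by linarith)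
    hsymp hinj (fun x y hx hy => hρ2.trans (hsep₂ x y hx hy)) hR
  rw [← hWo] at hWoI hWo01
  rw [← hWi] at hWiI
  have hχo := contDiff_radialCutoff_norm_sq (a := r) (b := r + η) (E := PhaseSpace n)
  have hco := hasCompactSupport_radialCutoff (E := PhaseSpace n) hr (show r < r + η by linarith)
  have hχi := contDiff_radialCutoff_norm_sq (a := s - η) (b := s) (E := PhaseSpace n)
  have hci := hasCompactSupport_radialCutoff (E := PhaseSpace n) (show 0 < s - η by linarith)
    (show s - η < s by linarith)
  have hWoint : Integrable Wo := integrable_smoothedDegree_target hg hχo hco hΦ hR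
  have hWiint : Integrable Wi := integrable_smoothedDegree_target hg hχi hci hΦ hR
  -- Each collar sits on the side of its sphere giving the useful inequality: the outer cut-off is
  -- `1` on all of `B_r`, the inner one vanishes outside `B_s`.
  have hWovol : volume.real (closedBall (0 : PhaseSpace n) r) ≤ ∫ p, Wo p := by
    rw [hWo, integral_smoothedDegree_radialCutoff hn hg hΦ hr (by linarith)
      (fun x hx => hsymp x ⟨by linarith [hx.1], by linarith [hx.2]⟩) hR]
    exact volume_closedBall_le_integral_radialCutoff hr (by linarith)
  have hWivol : ∫ p, Wi p ≤ volume.real (closedBall (0 : PhaseSpace n) s) := by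
    rw [hWi, integral_smoothedDegree_radialCutoff hn hg hΦ (by linarith) (by linarith)
      (fun x hx => hsymp x ⟨by linarith [hx.1], by linarith [hx.2]⟩) hR]
    exact integral_radialCutoff_le_volume_closedBall (by linarith) (by linarith)
  have hV0 := volume_real_ball_pos (n := n)
  have hind : ∀ t : ℝ,
      Integrable ((closedBall (0 : PhaseSpace n) t).indicator (1 : PhaseSpace n → ℝ)) := fun t => (integrable_indicator_iff measurableSet_closedBall).2
      (integrableOn_const measure_closedBall_lt_top.ne)
  have hpow : ∀ {u v : ℝ}, 0 ≤ u → 0 ≤ v →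
      volume.real (closedBall (0 : PhaseSpace n) u) ≤ volume.real (closedBall (0 : PhaseSpace n) v)
      → u ≤ v := by
    intro u v hu hv huv
    rw [volume_real_closedBall u hu, volume_real_closedBall v hv] at huv
    exact le_of_pow_le_pow_left₀ (by omega) hv (le_of_mul_le_mul_right huv hV0)
  have hr1 : r < 1 := by
    refine lt_of_le_of_lt (hpow hr.le (by linarith) (hWovol.trans ?_)) hρ4
    rw [← integral_indicator_one measurableSet_closedBall]
    refine integral_mono hWoint (hind _) fun p => ?_
    by_cases hp : p ∈ closedBall (0 : PhaseSpace n) (R + ρ)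
    · simpa [indicator_of_mem hp] using (hWoI p).2
    · rw [indicator_of_notMem hp]
      rw [mem_closedBall_zero_iff, not_le] at hp
      exact (smoothedDegree_eq_zero hg hR hp.le).le
  refine ⟨hr1, fun hεδ => ?_⟩
  let B : Set (PhaseSpace n) := closedBall 0 (1 - ε)
  have hε1 : 0 < 1 - ε := by linarith [hε.2]
  have hBfar : ∀ q ∈ B, ∀ x, s - η ≤ ‖x‖ ∧ ‖x‖ ≤ r + 3 * η → ρ ≤ ‖Φ x - q‖ := by
    intro q hq x hx
    have h1 := hgap x hx
    have h2 : ‖q‖ ≤ 1 - ε := by simpa [B] using hq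
    linarith [norm_sub_norm_le (Φ x) q]
  -- The two degrees differ by a contribution of the shell, whose image stays `ρ` away from `B`.
  have hWoi : ∀ q ∈ B, Wo q = Wi q := by
    intro q hq
    rw [← sub_eq_zero, hWo, hWi, smoothedDegree_sub hg hΦ (by linarith) (by linarith) hr
      (by linarith), ← integral_zero (PhaseSpace n) ℝ]
    congr 1
    ext x
    by_cases hx : s - η ≤ ‖x‖ ∧ ‖x‖ ≤ r + η
    · rw [hg.eq_zero _ (hBfar q hq x ⟨hx.1, by linarith [hx.2]⟩)]
      ring
    · rw [radialCutoff_sub_eq_zero (by linarith) (by linarith) hsr (by linarith) hx, zero_mul]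
  have h0B : (0 : PhaseSpace n) ∈ B := by simp [B, hε1.le]
  have hWoc : ∀ q ∈ B, Wo q = Wo 0 := fun q hq =>
    eq_of_fderiv_eq_zero_on_segment
      (fun p => (hasFDerivAt_smoothedDegree hg hχo hco hΦ p).differentiableAt) fun z hz =>
      fderiv_smoothedDegree_eq_zero hg hχo hco hΦ fun x hx => by
        have h1 := fderiv_radialCutoff_norm_sq hr (by linarith) hx
        exact hBfar z ((convex_closedBall 0 _).segment_subset hq h0B hz) x
          ⟨by linarith [h1.1], by linarith [h1.2]⟩
  rcases hWo01 0 fun x hx => hBfar 0 h0B x ⟨by linarith [hx.1], by linarith [hx.2]⟩ with hc | hc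
  -- Degree `0` on `B`: the enclosed region and `B` are disjoint inside the unit ball, so their
  -- volumes add up to at most its volume.
  · have h1 : ∫ p, (Wo p + B.indicator (1 : PhaseSpace n → ℝ) p) ≤
        volume.real (closedBall (0 : PhaseSpace n) 1) := by
      rw [← integral_indicator_one measurableSet_closedBall]
      refine integral_mono (hWoint.add (hind _)) (hind _) fun p => ?_
      have hBsub : B ⊆ closedBall 0 1 := closedBall_subset_closedBall (by linarith [hε.1])
      simp only
      by_cases hp : p ∈ B
      · rw [indicator_of_mem hp, indicator_of_mem (hBsub hp), hWoc p hp, hc, zero_add]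
      · rw [indicator_of_notMem hp, add_zero]
        by_cases hp1 : p ∈ closedBall (0 : PhaseSpace n) 1
        · simpa [indicator_of_mem hp1] using (hWoI p).2
        · rw [indicator_of_notMem hp1]
          rw [mem_closedBall_zero_iff, not_le] at hp1
          exact (smoothedDegree_eq_zero hg hR (by linarith)).le
    rw [integral_add hWoint (hind _), integral_indicator_one measurableSet_closedBall] at h1
    have h2 := add_le_of_add_le_right h1 hWovol
    rw [volume_real_closedBall _ hr.le, volume_real_closedBall _ hε1.le,
      volume_real_closedBall _ zero_le_one, ← add_mul, one_pow] at h2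
    linarith [le_of_mul_le_mul_right h2 hV0]
  -- Degree `1` on `B`: the inner sphere encloses `B` as well, so `1 - ε ≤ r (1 - δ) < 1 - δ`,
  -- contradicting `ε ≤ δ`.
  · exfalso
    have h1 : volume.real B ≤ ∫ p, Wi p := by
      rw [← integral_indicator_one measurableSet_closedBall]
      refine integral_mono (hind _) hWiint fun p => ?_
      by_cases hp : p ∈ B
      · rw [indicator_of_mem hp, ← hWoi p hp, hWoc p hp, hc]; rfl
      · rw [indicator_of_notMem hp]
        exact (hWiI p).1
    have h2 := hpow hε1.le (by linarith) (h1.trans hWivol)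
    have h3 : r * (1 - δ) < 1 - δ := by nlinarith [hδ.2]
    linarith

end ShellEmbedding

/-! ### Values of the capacity and the jump at `δ`. -/

theorem symplecticallyEmbeds_of_subset {n : ℕ} {A V : Set (PhaseSpace n)} (hV : IsOpen V)
    (h : A ⊆ V) : SymplecticallyEmbeds A V :=
  ⟨V, fun x => x, h, hV, contDiffOn_id, IsEmbedding.subtypeVal, fun _ hx => hx, fun p _ v w => by
    simp⟩

theorem shellCapacity_openShell_of_lt {n : ℕ} (hn : 2 ≤ n) {δ ε : ℝ} (hδ : δ ∈ Ioo (0 : ℝ) 1)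
    (hε : ε ∈ Ioo (0 : ℝ) 1) (h : δ < ε) :
    shellCapacity δ (openShell n ε) = ENNReal.ofReal Real.pi := by
  apply le_antisymm
  · refine sSup_le ?_
    rintro _ ⟨r, hr, hemb, rfl⟩
    have hr1 := (hemb.radius_bounds hn hr hδ hε).1
    exact ENNReal.ofReal_le_ofReal
      (mul_le_of_le_one_right Real.pi_pos.le (pow_le_one₀ hr.le hr1.le))
  -- For `(1 - ε) / (1 - δ) < r < 1` the scaled shell already lies in `U_ε`; let `r` tend to `1`
  -- from below.
  · have htends : Filter.Tendsto (fun r : ℝ => ENNReal.ofReal (Real.pi * r ^ 2)) (𝓝[<] 1)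
        (𝓝 (ENNReal.ofReal Real.pi)) := by
      have hc : Continuous fun r : ℝ => ENNReal.ofReal (Real.pi * r ^ 2) :=
        ENNReal.continuous_ofReal.comp (by fun_prop)
      have := hc.tendsto 1
      simp only [one_pow, mul_one] at this
      exact this.mono_left nhdsWithin_le_nhds
    refine le_of_tendsto htends ?_
    have hδ1 : 0 < 1 - δ := by linarith [hδ.2]
    have hlt : (1 - ε) / (1 - δ) < 1 := by rw [div_lt_one hδ1]; linarith
    filter_upwards [Ioo_mem_nhdsLT hlt] with r hr
    have hr0 : 0 < r := lt_trans (div_pos (by linarith [hε.2]) hδ1) hr.1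
    have hopen : IsOpen (openShell n ε) := isOpen_ball.sdiff isClosed_closedBall
    refine le_sSup ⟨r, hr0, symplecticallyEmbeds_of_subset hopen fun x hx => ?_, rfl⟩
    rw [smul_closedShell hr0] at hx
    exact mem_openShell.2 ⟨((div_lt_iff₀ hδ1).1 hr.1).trans_le hx.1, hx.2.trans_lt hr.2⟩

theorem shellCapacity_openShell_le {n : ℕ} (hn : 2 ≤ n) {δ ε : ℝ} (hδ : δ ∈ Ioo (0 : ℝ) 1)
    (hε : ε ∈ Ioo (0 : ℝ) 1) (h : ε ≤ δ) :
    shellCapacity δ (openShell n ε) ≤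
      ENNReal.ofReal ((1 - (1 - δ) ^ (2 * n)) ^ (1 / (n : ℝ)) * Real.pi) := by
  refine sSup_le ?_
  rintro _ ⟨r, hr, hemb, rfl⟩
  have h1 := (hemb.radius_bounds hn hr hδ hε).2 h
  -- This replaces the `ε`-dependent bound by its largest value over `ε ≤ δ`, attained at `ε = δ`.
  have h2 : (1 - δ) ^ (2 * n) ≤ (1 - ε) ^ (2 * n) := by
    have : 0 ≤ 1 - δ := by linarith [hδ.2]
    gcongr
  have hn0 : n ≠ 0 := by omega
  refine ENNReal.ofReal_le_ofReal ?_
  rw [mul_comm]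
  refine mul_le_mul_of_nonneg_right ?_ Real.pi_pos.le
  calc r ^ 2 = ((r ^ 2) ^ n) ^ (1 / (n : ℝ)) := by
        rw [one_div, Real.pow_rpow_inv_natCast (by positivity) hn0]
    _ ≤ _ := by
        rw [← pow_mul]
        exact Real.rpow_le_rpow (by positivity) (by linarith) (by positivity)

theorem theorem2 (n : ℕ) (hn : 2 ≤ n) (δ : ℝ) (hδ : δ ∈ Set.Ioo (0 : ℝ) 1) :
    ¬ ContinuousWithinAt (fun ε : ℝ => shellCapacity δ (openShell n ε)) (Set.Ioo 0 1) δ ∧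
    (∀ ε ∈ Set.Ioo (0 : ℝ) 1, ε ≤ δ →
      shellCapacity δ (openShell n ε) ≤
        ENNReal.ofReal ((1 - (1 - δ) ^ (2 * n)) ^ (1 / (n : ℝ)) * Real.pi)) ∧
    (∀ ε ∈ Set.Ioo (0 : ℝ) 1, δ < ε →
      shellCapacity δ (openShell n ε) = ENNReal.ofReal Real.pi) := by
  refine ⟨fun hcont => ?_, fun ε hε h => shellCapacity_openShell_le hn hδ hε h,
    fun ε hε h => shellCapacity_openShell_of_lt hn hδ hε h⟩
  -- Only the approach from the right matters: there the function is constantly `π`, while its value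
  -- at `δ` is strictly smaller.
  have h1 : Filter.Tendsto (fun ε : ℝ => shellCapacity δ (openShell n ε)) (𝓝[Ioo δ 1] δ)
      (𝓝 (shellCapacity δ (openShell n δ))) :=
    hcont.mono_left (nhdsWithin_mono _ (Ioo_subset_Ioo_left hδ.1.le))
  have h2 : (fun ε : ℝ => shellCapacity δ (openShell n ε)) =ᶠ[𝓝[Ioo δ 1] δ]
      fun _ => ENNReal.ofReal Real.pi := by
    filter_upwards [self_mem_nhdsWithin] with ε hε
    exact shellCapacity_openShell_of_lt hn hδ ⟨hδ.1.trans hε.1, hε.2⟩ hε.1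
  have hne : (𝓝[Ioo δ 1] δ).NeBot := by
    rw [nhdsWithin_Ioo_eq_nhdsGT hδ.2]
    infer_instance
  have heq := tendsto_nhds_unique h1 (tendsto_const_nhds.congr' h2.symm)
  have hle := shellCapacity_openShell_le hn hδ hδ le_rfl
  rw [heq] at hle
  have hδ1 : 0 < 1 - δ := by linarith [hδ.2]
  have hx0 : (1 - δ) ^ (2 * n) ≤ 1 := pow_le_one₀ hδ1.le (by linarith [hδ.1])
  have hx1 : 0 < (1 - δ) ^ (2 * n) := by positivity
  have hlt : (1 - (1 - δ) ^ (2 * n)) ^ (1 / (n : ℝ)) < 1 :=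
    Real.rpow_lt_one (by linarith) (by linarith) (by positivity)
  refine absurd hle (not_le.2 ?_)
  rw [ENNReal.ofReal_lt_ofReal_iff Real.pi_pos]
  exact mul_lt_of_lt_one_left Real.pi_pos hlt
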